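/- Let $n\ge 5$, let $U\subset\mathbb R^n$ be open and simply connected, with coordinates $u=(u^1,\dots,u^n)$, and write $\partial_i=\partial/\partial u^i$; all functions are smooth on $U$. Let $u^i_t=v^i(u)u^i_x$, $i=1,\dots,n$, be a strictly hyperbolic system (the $v^i(u)$ are real and pairwise distinct at every $u\in U$), and let $g=\sum_i g_{ii}(u)(du^i)^2$ be a non-degenerate diagonal metric such that, for suitable non-vanishing functions $f^i(u^i)$ of one variable, $\sum_i g_{ii}f^i(u^i)(du^i)^2$ is a flat metric for which the system is a Dubrovin–Novikov (DN) system, i.e. its covariant derivative $\widetilde\nabla$ satisfies $\widetilde\nabla^i\widetilde\nabla_k h=\delta^i_k v^i$ for some Hamiltonian density $h$ on $U$. Let $\Gamma^i_{jk}$, $\nabla$ and $R^{ij}_{kl}$ be the Christoffel symbols, the covariant derivative and the curvature tensor of $g$ (with the sign for which $R^{ij}_{ij}=c$, $i\ne j$, on a space of constant curvature $c$). An affinor of $g$ is a family $w^i(u)$ with $\partial_jw^i=(w^j-w^i)\,\Gamma^i_{ij}$ for $j\neq i$. Let $d\hat x=B\,dx+A\,dt$, $d\hat t=N\,dx+M\,dt$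 be a reciprocal transformation: $B_t=A_x$ and $N_t=M_x$ are conservation laws of the system, i.e. $\partial_iA=v^i\partial_iB$ and $\partial_iM=v^i\partial_iN$, and $BM-AN\ne0$ on $U$. Suppose that the reciprocal metric $$\hat g_{ii}=\Big(\frac{M-Nv^i}{BM-AN}\Big)^2g_{ii}$$ is non-degenerate and flat on $U$. Then: (i) There are (possibly zero) affinors $w_{(1)},w_{(2)}$ of $g$ with $$R^{ij}_{ij}=w^i_{(1)}+w^j_{(1)}+w^i_{(2)}v^j+w^j_{(2)}v^i,\qquad i\ne j.$$ (ii) Let $w_{(1)},w_{(2)}$ be any affinors as in (i), and let $$J^{ij}=g^{ii}\Big(\delta^i_j\tfrac{d}{dx}-\sum_k\Gamma^j_{ik}u^k_x\Big)+w^i_{(1)}u^i_x\big(\tfrac d{dx}\big)^{-1}u^j_x+u^i_x\big(\tfrac d{dx}\big)^{-1}w^j_{(1)}u^j_x+w^i_{(2)}u^i_x\big(\tfrac d{dx}\big)^{-1}v^ju^j_x+v^iu^i_x\big(\tfrac d{dx}\big)^{-1}w^j_{(2)}u^j_x$$ be the corresponding Hamiltonian operator of $g$. On a conserved density $h$ with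 flux $a$ ($\partial_ia=v^i\partial_ih$) and with functions $T_1,T_2$ satisfying $\partial_iT_l=w^i_{(l)}\partial_ih$, $l=1,2$, it acts, with the convention $(d/dx)^{-1}f_x=f$, by $$\sum_jJ^{ij}\partial_jh=\big(\nabla^i\nabla_ih+w^i_{(1)}h+T_1+w^i_{(2)}a+v^iT_2\big)u^i_x .$$ Such functions $T_1,T_2$ exist for $(h,a)=(B,A)$ and for $(h,a)=(N,M)$, and for every choice of them the auxiliary flows generated by $B$ and $N$ are linear combinations of the $x$- and $t$-flows: there are constants $\kappa_1,\dots,\kappa_4$ such that, for $i=1,\dots,n$, $$\sum_jJ^{ij}\partial_jB=(\kappa_1+\kappa_2v^i)u^i_x,\qquad \sum_jJ^{ij}\partial_jN=(\kappa_3+\kappa_4v^i)u^i_x .$$ Moreover the transformation is canonical with respect to $J$: $B$ and $N$ are linear combinations with constant coefficients of canonical integrals of $J$. That is, call a conserved density, taken together with $a,T_1,T_2$, a Casimir, a momentum or a Hamiltonian if it generates the flow $0$, $u^i_x$ or $v^iu^i_x$ respectively; then momenta $P$ and Hamiltonians $H$ exist, and for each choice of $P$ and $H$ there are constants $\alpha,\beta$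 and a Casimir $C$ with $B=C+\alpha P+\beta H$ (for the densities and, simultaneously, for $a,T_1,T_2$), and likewise for $N$. -/

import Mathlib

open scoped ContDiff

noncomputable section

namespace Hydro

/-- Scalar functions of the Riemann invariants `u = (u^1, …, u^n)`. -/
abbrev Scal (n : ℕ) := (Fin n → ℝ) → ℝ

variable {n : ℕ}

/-- The partial derivative `∂_i f`. It is only used on open sets on which `f` is smooth. -/
def pd (i : Fin n) (f : Scal n) : Scal n := fun u => fderiv ℝ f u (Pi.single i 1)

/-! ### Diagonal metrics `ds² = ∑ g_i (du^i)²` -/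

/-- `g_i` are the diagonal entries of a smooth non-degenerate (possibly indefinite) diagonal
metric on `U`. -/
def IsDiagMetric (U : Set (Fin n → ℝ)) (g : Fin n → Scal n) : Prop :=
  ∀ i, ContDiffOn ℝ ∞ (g i) U ∧ ∀ u ∈ U, g i u ≠ 0

/-- The covariant metric tensor `g_{ij}` with diagonal entries `g_i`. -/
def metric (g : Fin n → Scal n) (i j : Fin n) : Scal n := fun u => if i = j then g i u else 0

/-- Christoffel symbols
`Γ^i_{jk} = ½ g^{ii} (∂_j g_{ik} + ∂_k g_{ij} - ∂_i g_{jk})` of a diagonal metric. -/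
def christoffel (g : Fin n → Scal n) (i j k : Fin n) : Scal n := fun u =>
  1 / 2 * (g i u)⁻¹ *
    (pd j (metric g i k) u + pd k (metric g i j) u - pd i (metric g j k) u)

/-- `R^i_{jkl}`, the `i`-th component of `R(∂_k, ∂_l) ∂_j`. -/
def riemann (g : Fin n → Scal n) (i j k l : Fin n) : Scal n := fun u =>
  pd k (christoffel g i l j) u - pd l (christoffel g i k j) u +
    ∑ m, (christoffel g i k m u * christoffel g m l j u -
      christoffel g i l m u * christoffel g m k j u)

/-- `R^{ij}_{kl} = g^{jj} R^i_{jkl}`; with this sign `R^{ij}_{ij} = c` (`i ≠ j`) on a space of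
constant curvature `c`. -/
def curv (g : Fin n → Scal n) (i j k l : Fin n) : Scal n := fun u =>
  (g j u)⁻¹ * riemann g i j k l u

/-- A smooth non-degenerate diagonal metric with vanishing Riemann tensor. -/
def IsFlatMetric (U : Set (Fin n → ℝ)) (g : Fin n → Scal n) : Prop :=
  IsDiagMetric U g ∧ ∀ i j k l, ∀ u ∈ U, riemann g i j k l u = 0

/-- `∇^i ∇_j h = g^{ii} (∂_i ∂_j h - ∑_m Γ^m_{ij} ∂_m h)`. -/
def hess (g : Fin n → Scal n) (h : Scal n) (i j : Fin n) : Scal n := fun u =>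
  (g i u)⁻¹ * (pd i (pd j h) u - ∑ m, christoffel g m i j u * pd m h u)

/-! ### Diagonal hydrodynamic type systems `u^i_t = v^i(u) u^i_x` -/

/-- Strict hyperbolicity: smooth velocities, pairwise distinct at every point. -/
def IsStrictlyHyperbolic (U : Set (Fin n → ℝ)) (v : Fin n → Scal n) : Prop :=
  (∀ i, ContDiffOn ℝ ∞ (v i) U) ∧ ∀ u ∈ U, ∀ i j, i ≠ j → v i u ≠ v j u

/-- The system `u^i_t = v^i u^i_x` is Hamiltonian for the local operator
`g^{ii} (δ^i_j d/dx - Γ^j_{ik} u^k_x)` of the flat diagonal metric `g`: there is a Hamiltonian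
density `h` whose velocity matrix `∇^i ∇_k h` is `diag (v^1, …, v^n)`. -/
def IsLocalHamiltonian (U : Set (Fin n → ℝ)) (v g : Fin n → Scal n) : Prop :=
  IsFlatMetric U g ∧ ∃ h : Scal n, ContDiffOn ℝ ∞ h U ∧
    ∀ u ∈ U, ∀ i k, hess g h i k u = if i = k then v i u else 0

/-- The system `u^i_t = v^i u^i_x` is a Dubrovin-Novikov system and `g` is one of its metrics:
`g` is a diagonal metric such that `g_i(u) f^i(u^i)`, for suitable non-vanishing functions `f^i`
of one variable, is a flat metric for which the system is Hamiltonian. -/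
def IsMetricOfDNSystem (U : Set (Fin n → ℝ)) (v g : Fin n → Scal n) : Prop :=
  IsDiagMetric U g ∧ ∃ f : Fin n → ℝ → ℝ,
    (∀ i, ContDiffOn ℝ ∞ (f i) ((fun u : Fin n → ℝ => u i) '' U)) ∧
    (∀ i, ∀ u ∈ U, f i (u i) ≠ 0) ∧
    IsLocalHamiltonian U v (fun i u => g i u * f i (u i))

/-- `h(u)_t = a(u)_x` holds along the system `u^i_t = v^i u^i_x`, i.e. `∂_i a = v^i ∂_i h`. -/
def IsConservationLaw (U : Set (Fin n → ℝ)) (v : Fin n → Scal n) (h a : Scal n) : Prop :=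
  ContDiffOn ℝ ∞ h U ∧ ContDiffOn ℝ ∞ a U ∧ ∀ u ∈ U, ∀ i, pd i a u = v i u * pd i h u

/-- `w` is an affinor of the metric `g`: `∂_j w^i = (w^j - w^i) ∂_j ln H_i` for `j ≠ i`, where
`H_i² = g_i`, so that `∂_j ln H_i = Γ^i_{ij}`. -/
def IsAffinor (U : Set (Fin n → ℝ)) (g w : Fin n → Scal n) : Prop :=
  (∀ i, ContDiffOn ℝ ∞ (w i) U) ∧
    ∀ u ∈ U, ∀ i j, i ≠ j → pd j (w i) u = (w j u - w i u) * christoffel g i i j u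

/-- `R^{ij}_{ij} = w₁^i + w₁^j + w₂^i v^j + w₂^j v^i` for `i ≠ j`. -/
def HasSpecialCurvature (U : Set (Fin n → ℝ)) (v g w₁ w₂ : Fin n → Scal n) : Prop :=
  ∀ u ∈ U, ∀ i j, i ≠ j →
    curv g i j i j u = w₁ i u + w₁ j u + w₂ i u * v j u + w₂ j u * v i u

/-! ### Reciprocal transformations -/

/-- `dx̂ = B dx + A dt`, `dt̂ = N dx + M dt` is a reciprocal transformation of the system. -/
def IsReciprocal (U : Set (Fin n → ℝ)) (v : Fin n → Scal n) (B A N M : Scal n) : Prop :=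
  IsConservationLaw U v B A ∧ IsConservationLaw U v N M ∧
    ∀ u ∈ U, B u * M u - A u * N u ≠ 0

/-- The reciprocal metric `ĝ_i = ((M - N v^i) / (B M - A N))² g_i`. -/
def recMetric (v g : Fin n → Scal n) (B A N M : Scal n) (i : Fin n) : Scal n := fun u =>
  ((M u - N u * v i u) / (B u * M u - A u * N u)) ^ 2 * g i u

/-! ### The Hamiltonian operator of a metric with special curvature

For `R^{ij}_{ij} = w₁^i + w₁^j + w₂^i v^j + w₂^j v^i` the Hamiltonian operator of `g` is
`J^{ij} = g^{ii} (δ^i_j d/dx - Γ^j_{ik} u^k_x)`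
`  + w₁^i u^i_x (d/dx)⁻¹ u^j_x + u^i_x (d/dx)⁻¹ w₁^j u^j_x`
`  + w₂^i u^i_x (d/dx)⁻¹ v^j u^j_x + v^i u^i_x (d/dx)⁻¹ w₂^j u^j_x`.
It is applied to the gradient of a conserved density `h` with flux `a`. With the convention
`(d/dx)⁻¹ f_x = f`, the four nonlocal terms are obtained from
`∂_j h u^j_x = h_x`, `v^j ∂_j h u^j_x = a_x`, `w₁^j ∂_j h u^j_x = (T₁)_x` and
`w₂^j ∂_j h u^j_x = (T₂)_x`. -/

/-- A density `h` together with its flux `a` along the `t`-flow and its fluxes `T₁`, `T₂` along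
the flows with velocities `w₁`, `w₂`. -/
structure Integral (n : ℕ) where
  h : Scal n
  a : Scal n
  T₁ : Scal n
  T₂ : Scal n

/-- `D.h` is a conserved density, with fluxes `D.a`, `D.T₁`, `D.T₂`. -/
def Integral.IsConserved (U : Set (Fin n → ℝ)) (v w₁ w₂ : Fin n → Scal n)
    (D : Integral n) : Prop :=
  IsConservationLaw U v D.h D.a ∧ IsConservationLaw U w₁ D.h D.T₁ ∧
    IsConservationLaw U w₂ D.h D.T₂

/-- The velocities `b^i` of the flow `J^{ij} ∂_j h = b^i u^i_x`. -/
def Integral.flow (v g w₁ w₂ : Fin n → Scal n) (D : Integral n) (i : Fin n) : Scal n := fun u =>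
  hess g D.h i i u + w₁ i u * D.h u + D.T₁ u + w₂ i u * D.a u + v i u * D.T₂ u

/-- `D` is conserved and its flow has velocities `c^i`. A Casimir has `c^i = 0`, a momentum
`c^i = 1` (the `x`-flow), a Hamiltonian of the system `c^i = v^i` (the `t`-flow). -/
def Integral.Generates (U : Set (Fin n → ℝ)) (v g w₁ w₂ : Fin n → Scal n) (D : Integral n)
    (c : Fin n → Scal n) : Prop :=
  D.IsConserved U v w₁ w₂ ∧ ∀ u ∈ U, ∀ i, D.flow v g w₁ w₂ i u = c i u

def Integral.IsCasimir (U : Set (Fin n → ℝ)) (v g w₁ w₂ : Fin n → Scal n)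
    (D : Integral n) : Prop :=
  D.Generates U v g w₁ w₂ (fun _ _ => 0)

def Integral.IsMomentum (U : Set (Fin n → ℝ)) (v g w₁ w₂ : Fin n → Scal n)
    (D : Integral n) : Prop :=
  D.Generates U v g w₁ w₂ (fun _ _ => 1)

def Integral.IsHamiltonian (U : Set (Fin n → ℝ)) (v g w₁ w₂ : Fin n → Scal n)
    (D : Integral n) : Prop :=
  D.Generates U v g w₁ w₂ v

/-- `D = C + α P + β H` on `U`, for the density and for all its fluxes. -/
def Integral.IsCombination (U : Set (Fin n → ℝ)) (D C P H : Integral n) (α β : ℝ) : Prop :=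
  ∀ u ∈ U,
    D.h u = C.h u + α * P.h u + β * H.h u ∧
    D.a u = C.a u + α * P.a u + β * H.a u ∧
    D.T₁ u = C.T₁ u + α * P.T₁ u + β * H.T₁ u ∧
    D.T₂ u = C.T₂ u + α * P.T₂ u + β * H.T₂ u

/-- `D` is a linear combination, with constant coefficients, of canonical integrals of `J`
(Casimirs, momentum, Hamiltonian), and this whichever momentum `P` and Hamiltonian `H` are used: up
to multiples of `P` and `H` it is a Casimir. -/
def Integral.IsCanonical (U : Set (Fin n → ℝ)) (v g w₁ w₂ : Fin n → Scal n)
    (D : Integral n) : Prop :=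
  (∃ P H : Integral n, P.IsMomentum U v g w₁ w₂ ∧ H.IsHamiltonian U v g w₁ w₂) ∧
  ∀ P H : Integral n, P.IsMomentum U v g w₁ w₂ → H.IsHamiltonian U v g w₁ w₂ →
    ∃ (C : Integral n) (α β : ℝ), C.IsCasimir U v g w₁ w₂ ∧ D.IsCombination U C P H α β

end Hydro

end

/-!
The theorem rests on one formula for the curvature of `g` and on the Ricci identity.

*Affinors.* The off-diagonal curvatures of `g` vanish and `v` is an affinor of `g`: both properties
concern only the symbols `Γ^i_{ij} = ∂_j ln H_i` with `j ≠ i`, which `g` shares with the flat metric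
`g_i f^i(u^i)`, and for the latter the second one is the Ricci identity for the Hamiltonian density
(`IsMetricOfDNSystem.isSemiHamiltonian`, `IsMetricOfDNSystem.pd_velocity`). It follows that the
Hessians of `B` and `N` are diagonal; let `ρ^i`, `σ^i` be their eigenvalues.

*Curvature.* Put `D = B M - A N`, `α_i = (M - N v^i) / D`, `γ_i = (B v^i - A) / D`, so that
`ĝ_i = α_i² g_i`. Comparing the curvatures of `g` and `ĝ` (`curv_eq_of_rescaled`) one finds for
flat `ĝ` that
`R^{ij}_{ij} = -(α_j ρ^i + γ_j σ^i + α_i ρ^j + γ_i σ^j) + α_i α_j (∇B, ∇B)`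
`  + (α_i γ_j + α_j γ_i) (∇B, ∇N) + γ_i γ_j (∇N, ∇N)`.
As `α_i` and `γ_i` are affine in `v^i`, this has the form `w₁^i + w₁^j + w₂^i v^j + w₂^j v^i`. Here
`ρ^i + w₁^i B + w₂^i A` and `σ^i + w₁^i N + w₂^i M` are affine in `v^i`, with the same coefficients
for all `i` (`exists_curvatureData`): the flows of `B` and `N` vanish for a suitable choice of `T₁`
and `T₂`.

*Integration.* The `w₁^i`, `w₂^i` are determined only up to `w₁ - c v`, `w₂ + c` with a function
`c(u)`. By the Ricci identity for `B` and `N` (`IsDiagMetric.hasPd_hess`) their deviation from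
affinors is a one-form `∑ ε_j du^j`, which also is the obstruction for `T₁`, `T₂` to be fluxes. It is
closed (`CurvatureData.Defect.closed`), hence exact on the simply connected set `U`, and a primitive
`c` of it corrects everything at once (`IsReciprocal.exists_affinors`).

*Uniqueness.* For `n ≥ 5` the remaining freedom in `w₁`, `w₂` is a constant `c`
(`HasSpecialCurvature.exists_const`), by linear algebra in a space of signature `(2, 2)`. So for all
admissible affinors `B` and `N` are Casimirs up to the additive constants in `T₁` and `T₂`, and
these constants contribute `κ₁ + κ₂ v^i` to the flow.
-/

open scoped Topology

noncomputable section

/-! ### Closed one-forms on simply connected open sets -/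

/-- The real numbers with the discrete topology: the fibre of the covering space of local
primitives of a closed one-form. -/
def DiscreteReal : Type := ℝ

instance : AddCommGroup DiscreteReal := inferInstanceAs (AddCommGroup ℝ)

instance : TopologicalSpace DiscreteReal := ⊥

instance : DiscreteTopology DiscreteReal := ⟨rfl⟩

/-- Local primitives `F i` of one and the same one-form on balls `ball i (r i)` define a covering
space of `U`: the point over `x` with coordinate `c` in the chart `i` stands for the germ at `x` of
the primitive `F i + c`. -/
def primitiveCover {E : Type*} [NormedAddCommGroup E] [NormedSpace ℝ E] {U : Set E}
    (η : E → E →L[ℝ] ℝ) (r : U → ℝ) (F : U → E → ℝ) (hr : ∀ i, 0 < r i)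
    (hF : ∀ i : U, ∀ x ∈ Metric.ball (i : E) (r i), HasFDerivAt (F i) (η x) x) :
    FiberBundleCore U U DiscreteReal where
  baseSet i := {x | (x : E) ∈ Metric.ball (i : E) (r i)}
  isOpen_baseSet i := Metric.isOpen_ball.preimage continuous_subtype_val
  indexAt x := x
  mem_baseSet_at x := Metric.mem_ball_self (hr x)
  coordChange i j x c := c + (show DiscreteReal from (F i x - F j x : ℝ))
  coordChange_self i x _ c := by
    exact (congrArg (c + ·) (sub_self (F i x) : F i x - F i x = 0)).trans (add_zero c)
  continuousOn_coordChange i j := by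
    rintro ⟨x, c⟩ ⟨⟨hxi, hxj⟩, -⟩
    -- on the convex set `ball i ∩ ball j` the difference of the two primitives is constant
    have key : ∀ y : U, (y : E) ∈ Metric.ball (i : E) (r i) → (y : E) ∈ Metric.ball (j : E) (r j) →
        F i y - F j y = F i x - F j x := by
      intro y hyi hyj
      have hconv : Convex ℝ (Metric.ball (i : E) (r i) ∩ Metric.ball (j : E) (r j)) :=
        (convex_ball _ _).inter (convex_ball _ _)
      have hd : ∀ z ∈ Metric.ball (i : E) (r i) ∩ Metric.ball (j : E) (r j),
          HasFDerivWithinAt (fun z => F i z - F j z) (0 : E →L[ℝ] ℝ)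
            (Metric.ball (i : E) (r i) ∩ Metric.ball (j : E) (r j)) z := by
        intro z hz
        have := (hF i z hz.1).sub (hF j z hz.2)
        rw [sub_self] at this
        exact this.hasFDerivWithinAt
      have := hconv.norm_image_sub_le_of_norm_hasFDerivWithin_le (C := 0) hd
        (fun z _ => by simp) ⟨hxi, hxj⟩ ⟨hyi, hyj⟩
      simp only [zero_mul, norm_le_zero_iff, sub_eq_zero] at this
      exact this
    have hcont : Continuous (fun p : U × DiscreteReal =>
        p.2 + (show DiscreteReal from (F i x - F j x : ℝ))) :=
      (continuous_of_discreteTopology (f := fun c : DiscreteReal =>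
        c + (show DiscreteReal from (F i x - F j x : ℝ)))).comp continuous_snd
    refine hcont.continuousWithinAt.congr ?_ rfl
    rintro ⟨y, d⟩ ⟨⟨hyi, hyj⟩, -⟩
    exact congrArg (d + ·) (key y hyi hyj)
  coordChange_comp i j k x _ c := by
    exact (add_assoc c _ _).trans
      (congrArg (c + ·) (sub_add_sub_cancel (F i x) (F j x) (F k x)))

/-- A closed one-form on a simply connected open set has a primitive: a global section of the
covering space of local primitives exists, as the identity of the base lifts to it. -/
theorem IsSimplyConnected.exists_hasFDerivAt_of_fderiv_symmetric {E : Type*}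
    [NormedAddCommGroup E] [NormedSpace ℝ E] {U : Set E} (hU : IsOpen U)
    (hUsc : IsSimplyConnected U) {η : E → E →L[ℝ] ℝ} (hη : DifferentiableOn ℝ η U)
    (hsymm : ∀ a ∈ U, ∀ x y, fderiv ℝ η a x y = fderiv ℝ η a y x) :
    ∃ f : E → ℝ, ∀ a ∈ U, HasFDerivAt f (η a) a := by
  classical
  have := hUsc.simplyConnectedSpace
  have := hU.locallyPathConnectedSpace
  have hloc : ∀ i : U, ∃ r : ℝ, 0 < r ∧ ∃ F : E → ℝ,
      ∀ x ∈ Metric.ball (i : E) r, HasFDerivAt F (η x) x := by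
    intro i
    obtain ⟨r, hr, hsub⟩ := Metric.isOpen_iff.1 hU i i.2
    exact ⟨r, hr, (convex_ball _ _).exists_forall_hasFDerivAt_of_fderiv_symmetric
      Metric.isOpen_ball (hη.mono hsub) fun a ha => hsymm a (hsub ha)⟩
  choose r hr F hF using hloc
  let Z := primitiveCover η r F hr hF
  obtain ⟨x₀, hx₀⟩ := hUsc.nonempty
  have hcov : IsCoveringMap Z.proj := FiberBundle.isCoveringMap
  obtain ⟨s, ⟨-, hs⟩, -⟩ := hcov.existsUnique_continuousMap_lifts (ContinuousMap.id U)
    ⟨x₀, hx₀⟩ (⟨⟨x₀, hx₀⟩, (0 : DiscreteReal)⟩ : Z.TotalSpace) rfl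
  have hproj : ∀ x : U, (s x).proj = x := fun x => congrFun hs x
  let f : E → ℝ := fun x => if h : x ∈ U then
    F ⟨x, h⟩ x + (show ℝ from (Z.localTriv ⟨x, h⟩ (s ⟨x, h⟩)).2) else 0
  refine ⟨f, fun a ha => ?_⟩
  let i : U := ⟨a, ha⟩
  -- the coordinate of the section in the chart at `a` is `f - F i`, and it is locally constant
  have hcoord : ∀ x : U, (show ℝ from (Z.localTriv i (s x)).2) = f x - F i x := by
    intro x
    have h1 : ∀ j : U, (show ℝ from (Z.localTriv j (s x)).2) =
        (show ℝ from (s x).2) + (F x x - F j x) := by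
      intro j
      have h2 : (show ℝ from (Z.localTriv j (s x)).2) =
        (show ℝ from (s x).2) + (F (s x).proj (s x).proj - F j (s x).proj) := rfl
      rw [h2, hproj x]
    have hfx : f x = F x x + (show ℝ from (Z.localTriv x (s x)).2) := by
      simp only [f, x.2, dif_pos]
    rw [hfx, h1, h1]
    ring
  have hcont : ContinuousAt (fun x : U => (Z.localTriv i (s x)).2) i := by
    have hmem : s i ∈ (Z.localTriv i).source := by
      rw [FiberBundleCore.mem_localTriv_source, hproj i]
      exact Z.mem_baseSet_at i
    exact continuous_snd.continuousAt.comp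
      ((((Z.localTriv i).continuousOn_toFun.continuousAt
        ((Z.localTriv i).open_source.mem_nhds hmem))).comp s.continuous.continuousAt)
  have hev : ∀ᶠ x : U in 𝓝 i, (Z.localTriv i (s x)).2 = (Z.localTriv i (s i)).2 :=
    hcont.eventually
      (p := fun c => c = (Z.localTriv i (s i)).2)
      (by rw [nhds_discrete]; exact Filter.eventually_pure.2 rfl)
  have hev' : ∀ᶠ x in 𝓝 a, f x = F i x + (f a - F i a) := by
    have h1 : ∀ᶠ x : U in 𝓝 i, f x = F i x + (f a - F i a) := by
      filter_upwards [hev] with x hx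
      have h2 : f x - F i x = f i - F i i := by
        rw [← hcoord x, ← hcoord i]; exact hx
      show f x = F i x + (f i - F i i)
      linarith
    have h3 := (map_nhds_subtype_coe_eq_nhds (p := (· ∈ U)) ha (hU.mem_nhds ha))
    rw [← h3]
    exact h1
  exact ((hF i a (Metric.mem_ball_self (hr i))).add_const _).congr_of_eventuallyEq hev'

namespace Hydro

variable {n : ℕ}

/-! ### Calculus of partial derivatives -/

/-- `f` is differentiable at `u` and its `i`-th partial derivative there is `d`. -/
structure HasPd (i : Fin n) (f : Scal n) (d : ℝ) (u : Fin n → ℝ) : Prop where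
  differentiableAt : DifferentiableAt ℝ f u
  pd_eq : pd i f u = d

section HasPd
variable {i : Fin n} {f f' : Scal n} {d d' : ℝ} {u : Fin n → ℝ} {U : Set (Fin n → ℝ)}

theorem HasPd.of_hasFDerivAt {L : (Fin n → ℝ) →L[ℝ] ℝ} (h : HasFDerivAt f L u) :
    HasPd i f (L (Pi.single i 1)) u :=
  ⟨h.differentiableAt, by rw [pd, h.fderiv]⟩

theorem HasPd.congr_deriv (h : HasPd i f d u) (e : d = d') : HasPd i f d' u := e ▸ h

theorem HasPd.const (c : ℝ) : HasPd i (fun _ => c) 0 u :=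
  ⟨differentiableAt_const c, by simp [pd]⟩

theorem HasPd.add (h : HasPd i f d u) (h' : HasPd i f' d' u) :
    HasPd i (fun u => f u + f' u) (d + d') u :=
  (of_hasFDerivAt (h.1.hasFDerivAt.add h'.1.hasFDerivAt)).congr_deriv (by
    rw [← h.2, ← h'.2]; rfl)

theorem HasPd.sub (h : HasPd i f d u) (h' : HasPd i f' d' u) :
    HasPd i (fun u => f u - f' u) (d - d') u :=
  (of_hasFDerivAt (h.1.hasFDerivAt.sub h'.1.hasFDerivAt)).congr_deriv (by
    rw [← h.2, ← h'.2]; rfl)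

theorem HasPd.neg (h : HasPd i f d u) : HasPd i (fun u => -f u) (-d) u :=
  (of_hasFDerivAt h.1.hasFDerivAt.neg).congr_deriv (by rw [← h.2]; rfl)

theorem HasPd.mul (h : HasPd i f d u) (h' : HasPd i f' d' u) :
    HasPd i (fun u => f u * f' u) (f u * d' + d * f' u) u :=
  (of_hasFDerivAt (h.1.hasFDerivAt.mul h'.1.hasFDerivAt)).congr_deriv (by
    rw [← h.2, ← h'.2]; simp only [pd, add_apply, smul_apply, smul_eq_mul]; ring)

theorem HasPd.inv (h : HasPd i f d u) (h0 : f u ≠ 0) :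
    HasPd i (fun u => (f u)⁻¹) (-d / f u ^ 2) u :=
  (of_hasFDerivAt ((hasDerivAt_inv h0).comp_hasFDerivAt u h.1.hasFDerivAt)).congr_deriv (by
    rw [← h.2]; simp [pd]; ring)

theorem HasPd.div (h : HasPd i f d u) (h' : HasPd i f' d' u) (h0 : f' u ≠ 0) :
    HasPd i (fun u => f u / f' u) ((d * f' u - f u * d') / f' u ^ 2) u := by
  simp only [div_eq_mul_inv (f _)]
  exact (h.mul (h'.inv h0)).congr_deriv (by field_simp; ring)

theorem HasPd.sum {ι : Type*} {s : Finset ι} {F : ι → Scal n} {d : ι → ℝ}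
    (h : ∀ m ∈ s, HasPd i (F m) (d m) u) :
    HasPd i (fun u => ∑ m ∈ s, F m u) (∑ m ∈ s, d m) u :=
  (of_hasFDerivAt (HasFDerivAt.fun_sum fun m hm => (h m hm).1.hasFDerivAt)).congr_deriv (by
    rw [sum_apply]
    exact Finset.sum_congr rfl fun m hm => (h m hm).2)

theorem HasPd.congr_of_eqOn (h : HasPd i f d u) (hU : IsOpen U) (hu : u ∈ U)
    (he : ∀ u ∈ U, f' u = f u) : HasPd i f' d u := by
  have he' : f' =ᶠ[𝓝 u] f := Filter.eventually_of_mem (hU.mem_nhds hu) he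
  exact ⟨h.1.congr_of_eventuallyEq he', by rw [← h.2, pd, pd, he'.fderiv_eq]⟩

theorem HasPd.unique (h : HasPd i f d u) (h' : HasPd i f d' u) : d = d' := h.2.symm.trans h'.2

/-- Two smooth expressions that agree on an open set have the same partial derivatives there. -/
theorem HasPd.eq_of_eqOn (h : HasPd i f d u) (h' : HasPd i f' d' u) (hU : IsOpen U) (hu : u ∈ U)
    (he : ∀ u ∈ U, f u = f' u) : d = d' :=
  h.unique (h'.congr_of_eqOn hU hu he)

theorem hasPd_of_contDiffOn (hU : IsOpen U) (hf : ContDiffOn ℝ ∞ f U) (hu : u ∈ U) (i : Fin n) :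
    HasPd i f (pd i f u) u :=
  ⟨(hf.contDiffAt (hU.mem_nhds hu)).differentiableAt (by simp), rfl⟩

theorem contDiffOn_pd (hU : IsOpen U) (hf : ContDiffOn ℝ ∞ f U) (i : Fin n) :
    ContDiffOn ℝ ∞ (pd i f) U :=
  (hf.fderiv_of_isOpen hU (by simp)).clm_apply contDiffOn_const

theorem pd_congr (hU : IsOpen U) (hu : u ∈ U) (he : ∀ u ∈ U, f u = f' u) (i : Fin n) :
    pd i f u = pd i f' u := by
  have he' : f =ᶠ[𝓝 u] f' := Filter.eventually_of_mem (hU.mem_nhds hu) he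
  rw [pd, pd, he'.fderiv_eq]

theorem pd_comm (hU : IsOpen U) (hf : ContDiffOn ℝ ∞ f U) (hu : u ∈ U) (i j : Fin n) :
    pd i (pd j f) u = pd j (pd i f) u := by
  have h2 : ContDiffAt ℝ ∞ f u := hf.contDiffAt (hU.mem_nhds hu)
  have hs : IsSymmSndFDerivAt ℝ f u := h2.isSymmSndFDerivAt (by
    simp
    exact WithTop.coe_le_coe.2 (le_top (a := (2 : ℕ∞))))
  have hd : DifferentiableAt ℝ (fderiv ℝ f) u :=
    (h2.fderiv_right (m := ∞) (by simp)).differentiableAt (by simp)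
  have key : ∀ k l : Fin n, pd k (pd l f) u =
      fderiv ℝ (fderiv ℝ f) u (Pi.single k 1) (Pi.single l 1) := by
    intro k l
    have : HasPd k (pd l f) _ u := HasPd.of_hasFDerivAt
      (hd.hasFDerivAt.clm_apply (hasFDerivAt_const (Pi.single l (1 : ℝ) : Fin n → ℝ) u))
    rw [this.pd_eq]
    simp
  rw [key, key]
  exact hs _ _

theorem clm_eq_sum_single (L : (Fin n → ℝ) →L[ℝ] ℝ) (x : Fin n → ℝ) :
    L x = ∑ i, x i * L (Pi.single i 1) := by
  conv_lhs => rw [← Finset.univ_sum_single x]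
  rw [map_sum]
  refine Finset.sum_congr rfl fun i _ => ?_
  rw [← smul_eq_mul, ← map_smul]
  congr 1
  ext k
  by_cases h : k = i
  · subst h; simp
  · simp [h]

theorem eq_const_of_pd_eq_zero (hU : IsOpen U) (hUc : IsPreconnected U)
    (hf : ContDiffOn ℝ ∞ f U) (h0 : ∀ u ∈ U, ∀ i, pd i f u = 0) :
    ∃ c : ℝ, ∀ u ∈ U, f u = c := by
  refine hU.exists_is_const_of_fderiv_eq_zero hUc (hf.differentiableOn (by simp)) fun u hu => ?_
  ext x
  rw [clm_eq_sum_single]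
  simpa using Finset.sum_eq_zero fun i _ => by
    have : fderiv ℝ f u (Pi.single i 1) = 0 := h0 u hu i
    simp [this]

/-- A closed one-form on a simply connected open set, given by its components, is exact. -/
theorem exists_pd_eq_of_closed (hU : IsOpen U) (hUsc : IsSimplyConnected U)
    {e : Fin n → Scal n} (he : ∀ i, ContDiffOn ℝ ∞ (e i) U)
    (hclosed : ∀ u ∈ U, ∀ i j, pd i (e j) u = pd j (e i) u) :
    ∃ f : Scal n, ContDiffOn ℝ ∞ f U ∧ ∀ u ∈ U, ∀ i, pd i f u = e i u := by
  let η : (Fin n → ℝ) → (Fin n → ℝ) →L[ℝ] ℝ := fun u =>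
    ∑ i, e i u • ContinuousLinearMap.proj (R := ℝ) (φ := fun _ : Fin n => ℝ) i
  have hη : ContDiffOn ℝ ∞ η U :=
    ContDiffOn.sum fun i _ => (he i).smul contDiffOn_const
  have hη1 : ∀ u (i : Fin n), η u (Pi.single i 1) = e i u := by
    intro u i
    simp [η, Pi.single_apply, sum_apply]
  have hd : DifferentiableOn ℝ η U := hη.differentiableOn (by simp)
  have hpd : ∀ u ∈ U, ∀ i j, fderiv ℝ η u (Pi.single i 1) (Pi.single j 1) = pd i (e j) u := by
    intro u hu i j
    have h1 : HasPd i (fun u => η u (Pi.single j 1)) _ u := HasPd.of_hasFDerivAt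
      ((hd.differentiableAt (hU.mem_nhds hu)).hasFDerivAt.clm_apply
        (hasFDerivAt_const (Pi.single j (1 : ℝ) : Fin n → ℝ) u))
    have h2 : pd i (e j) u = pd i (fun u => η u (Pi.single j 1)) u :=
      pd_congr hU hu (fun u _ => (hη1 u j).symm) i
    rw [h2, h1.pd_eq]
    simp
  obtain ⟨f, hf⟩ := hUsc.exists_hasFDerivAt_of_fderiv_symmetric hU hd (by
    intro u hu x y
    have h1 : ∀ x y : Fin n → ℝ, fderiv ℝ η u x y = ∑ i, ∑ j, x i * y j * pd i (e j) u := by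
      intro x y
      have h3 := clm_eq_sum_single ((fderiv ℝ η u).flip y) x
      simp only [ContinuousLinearMap.flip_apply] at h3
      rw [h3]
      refine Finset.sum_congr rfl fun i _ => ?_
      rw [clm_eq_sum_single, Finset.mul_sum]
      refine Finset.sum_congr rfl fun j _ => ?_
      rw [hpd u hu]
      ring
    rw [h1, h1, Finset.sum_comm]
    refine Finset.sum_congr rfl fun i _ => Finset.sum_congr rfl fun j _ => ?_
    rw [hclosed u hu]
    ring)
  refine ⟨f, ?_, fun u hu i => ?_⟩
  · have h1 : DifferentiableOn ℝ f U := fun u hu =>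
      (hf u hu).differentiableAt.differentiableWithinAt
    refine (contDiffOn_infty_iff_fderiv_of_isOpen hU).2 ⟨h1, hη.congr fun u hu => ?_⟩
    exact (hf u hu).fderiv
  · rw [pd, (hf u hu).fderiv, hη1]

end HasPd

/-! ### Diagonal metrics -/

/-- The Christoffel symbol `Γ^i_{ij} = ∂_j ln H_i` of the diagonal metric with entries
`g_i = ± H_i²`; all other Christoffel symbols are expressed through these. -/
def logLame (g : Fin n → Scal n) (i j : Fin n) : Scal n :=
  fun u => 1 / 2 * (g i u)⁻¹ * pd j (g i) u

theorem metric_self (g : Fin n → Scal n) (i : Fin n) : metric g i i = g i := by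
  funext u; simp [metric]

theorem pd_metric_of_ne (g : Fin n → Scal n) {i j : Fin n} (h : i ≠ j) (k : Fin n)
    (u : Fin n → ℝ) : pd k (metric g i j) u = 0 := by
  have : metric g i j = fun _ => 0 := by funext u; simp [metric, h]
  rw [this]
  exact (HasPd.const 0).pd_eq

theorem christoffel_self_left (g : Fin n → Scal n) (i j : Fin n) (u : Fin n → ℝ) :
    christoffel g i i j u = logLame g i j u := by
  simp [christoffel, logLame, metric_self]

theorem christoffel_self_right (g : Fin n → Scal n) (i j : Fin n) (u : Fin n → ℝ) :
    christoffel g i j i u = logLame g i j u := by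
  have h : metric g j i = metric g i j := by
    funext u
    by_cases hij : i = j
    · subst hij; rfl
    · simp [metric, hij, Ne.symm hij]
  simp [christoffel, logLame, metric_self, h]

theorem christoffel_of_ne (g : Fin n → Scal n) {i j k : Fin n} (hij : i ≠ j) (hik : i ≠ k)
    (hjk : j ≠ k) (u : Fin n → ℝ) : christoffel g i j k u = 0 := by
  simp [christoffel, pd_metric_of_ne g hij, pd_metric_of_ne g hik, pd_metric_of_ne g hjk]

theorem christoffel_diag (g : Fin n → Scal n) {i j : Fin n} (hij : i ≠ j) {u : Fin n → ℝ}
    (hj : g j u ≠ 0) :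
    christoffel g i j j u = -(g i u)⁻¹ * g j u * logLame g j i u := by
  simp only [christoffel, pd_metric_of_ne g hij, metric_self, logLame]
  field_simp
  ring

theorem exists_notMem_of_card_lt {s : Finset (Fin n)} (h : s.card < n) : ∃ i, i ∉ s := by
  by_contra! hall
  rw [Finset.eq_univ_of_forall hall, Finset.card_univ, Fintype.card_fin] at h
  exact lt_irrefl _ h

theorem sum_eq_pair_add_compl {i j : Fin n} (hij : i ≠ j) (f : Fin n → ℝ) :
    ∑ m, f m = f i + f j + ∑ m ∈ ({i, j}ᶜ : Finset (Fin n)), f m := by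
  rw [← Finset.sum_add_sum_compl {i, j} f, Finset.sum_pair hij]

theorem mem_compl_pair {i j m : Fin n} :
    m ∈ ({i, j}ᶜ : Finset (Fin n)) ↔ m ≠ i ∧ m ≠ j := by simp

section
variable {U : Set (Fin n → ℝ)} {g : Fin n → Scal n} {u : Fin n → ℝ}

theorem IsDiagMetric.hasPd (hU : IsOpen U) (hg : IsDiagMetric U g) (hu : u ∈ U) (i j : Fin n) :
    HasPd j (g i) (2 * g i u * logLame g i j u) u :=
  (hasPd_of_contDiffOn hU (hg i).1 hu j).congr_deriv (by
    have := (hg i).2 u hu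
    rw [logLame]; field_simp)

theorem IsDiagMetric.hasPd_inv (hU : IsOpen U) (hg : IsDiagMetric U g) (hu : u ∈ U)
    (i j : Fin n) : HasPd j (fun u => (g i u)⁻¹) (-2 * (g i u)⁻¹ * logLame g i j u) u :=
  ((hg.hasPd hU hu i j).inv ((hg i).2 u hu)).congr_deriv (by
    have := (hg i).2 u hu
    field_simp)

theorem IsDiagMetric.contDiffOn_inv (hg : IsDiagMetric U g) (i : Fin n) :
    ContDiffOn ℝ ∞ (fun u => (g i u)⁻¹) U :=
  (hg i).1.inv (hg i).2

theorem IsDiagMetric.contDiffOn_logLame (hU : IsOpen U) (hg : IsDiagMetric U g) (i j : Fin n) :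
    ContDiffOn ℝ ∞ (logLame g i j) U :=
  (contDiffOn_const.mul (hg.contDiffOn_inv i)).mul (contDiffOn_pd hU (hg i).1 j)

/-- The mixed derivatives of `ln H_i` commute. -/
theorem IsDiagMetric.pd_logLame_comm (hU : IsOpen U) (hg : IsDiagMetric U g) (hu : u ∈ U)
    (i j k : Fin n) : pd k (logLame g i j) u = pd j (logLame g i k) u := by
  have key : ∀ j k : Fin n, pd k (logLame g i j) u =
      1 / 2 * (-2 * (g i u)⁻¹ * logLame g i k u * pd j (g i) u +
        (g i u)⁻¹ * pd k (pd j (g i)) u) := by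
    intro j k
    have h1 := ((HasPd.const (1 / 2)).mul (hg.hasPd_inv hU hu i k)).mul
      (hasPd_of_contDiffOn hU (contDiffOn_pd hU (hg i).1 j) hu k)
    rw [show logLame g i j = fun u => 1 / 2 * (g i u)⁻¹ * pd j (g i) u from rfl, h1.pd_eq]
    ring
  rw [key, key, pd_comm hU (hg i).1 hu j k]
  simp only [logLame]
  ring

/-- The sectional curvatures of a diagonal metric. -/
theorem IsDiagMetric.curv_eq (hU : IsOpen U) (hg : IsDiagMetric U g) (hu : u ∈ U) {i j : Fin n}
    (hij : i ≠ j) :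
    curv g i j i j u =
      -((g i u)⁻¹ * (pd i (logLame g j i) u + logLame g j i u ^ 2 -
          logLame g i i u * logLame g j i u) +
        (g j u)⁻¹ * (pd j (logLame g i j) u + logLame g i j u ^ 2 -
          logLame g j j u * logLame g i j u) +
        ∑ m ∈ ({i, j}ᶜ : Finset (Fin n)), (g m u)⁻¹ * (logLame g i m u * logLame g j m u)) := by
  have hi0 := (hg i).2 u hu
  have hj0 := (hg j).2 u hu
  have h1 : pd i (christoffel g i j j) u = _ :=
    (((hg.hasPd_inv hU hu i i).neg.mul (hg.hasPd hU hu j i)).mul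
      (hasPd_of_contDiffOn hU (hg.contDiffOn_logLame hU j i) hu i)).congr_of_eqOn hU hu
      (fun u hu => christoffel_diag g hij ((hg j).2 u hu)) |>.pd_eq
  have h2 : pd j (christoffel g i i j) u = pd j (logLame g i j) u :=
    pd_congr hU hu (fun u _ => christoffel_self_left g i j u) j
  have h3 : ∑ m ∈ ({i, j}ᶜ : Finset (Fin n)),
      (christoffel g i i m u * christoffel g m j j u -
        christoffel g i j m u * christoffel g m i j u) =
      -(g j u * ∑ m ∈ ({i, j}ᶜ : Finset (Fin n)),
        (g m u)⁻¹ * (logLame g i m u * logLame g j m u)) := by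
    rw [Finset.mul_sum, ← Finset.sum_neg_distrib]
    refine Finset.sum_congr rfl fun m hm => ?_
    obtain ⟨hmi, hmj⟩ := mem_compl_pair.1 hm
    rw [christoffel_self_left, christoffel_diag g hmj hj0, christoffel_of_ne g hmi hmj hij]
    ring
  rw [curv, riemann, h1, h2, sum_eq_pair_add_compl hij, h3]
  simp only [christoffel_self_left, christoffel_self_right, christoffel_diag g hij hj0]
  field_simp
  ring

/-- The curvature components with three distinct indices vanish, in terms of the coefficients
`Γ^i_{ij}`. This property is shared by all metrics `g_i(u) f^i(u^i)`. -/
def IsSemiHamiltonian (U : Set (Fin n → ℝ)) (g : Fin n → Scal n) : Prop :=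
  ∀ u ∈ U, ∀ i j k, i ≠ j → i ≠ k → j ≠ k →
    pd k (logLame g i j) u = logLame g i k u * logLame g k j u +
      logLame g i j u * logLame g j k u - logLame g i k u * logLame g i j u

theorem IsFlatMetric.isSemiHamiltonian (hU : IsOpen U) (hg : IsFlatMetric U g) :
    IsSemiHamiltonian U g := by
  intro u hu i j k hij hik hjk
  have h0 := hg.2 i j k i u hu
  have h1 : pd k (christoffel g i i j) u = pd k (logLame g i j) u :=
    pd_congr hU hu (fun u _ => christoffel_self_left g i j u) k
  have h2 : pd i (christoffel g i k j) u = 0 :=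
    ((HasPd.const 0).congr_of_eqOn hU hu
      (fun u _ => christoffel_of_ne g hik hij hjk.symm u)).pd_eq
  have h3 : ∑ m ∈ ({i, j}ᶜ : Finset (Fin n)),
      (christoffel g i k m u * christoffel g m i j u -
        christoffel g i i m u * christoffel g m k j u) =
      -(logLame g i k u * logLame g k j u) := by
    rw [Finset.sum_eq_single k]
    · rw [christoffel_of_ne g hik.symm hjk.symm hij, christoffel_self_left, christoffel_self_left]
      ring
    · intro m hm hmk
      obtain ⟨hmi, hmj⟩ := mem_compl_pair.1 hm
      rw [christoffel_of_ne g hmi hmj hij, christoffel_of_ne g hmk hmj hjk.symm]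
      ring
    · intro h
      exact absurd (mem_compl_pair.2 ⟨hik.symm, hjk.symm⟩) h
  rw [riemann, h1, h2, sum_eq_pair_add_compl hij, h3] at h0
  simp only [christoffel_self_left, christoffel_self_right,
    christoffel_of_ne g hik hij hjk.symm] at h0
  linear_combination h0

theorem IsFlatMetric.curv_eq_zero (hg : IsFlatMetric U g) (hu : u ∈ U) (i j k l : Fin n) :
    curv g i j k l u = 0 := by
  rw [curv, hg.2 i j k l u hu, mul_zero]

/-! ### Functions with diagonal Hessian -/

/-- `∇_i ∇_j h = 0` for `i ≠ j`. Densities of conservation laws of a diagonal system, whose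
velocities form an affinor of the metric, have this property. -/
def HasDiagHess (U : Set (Fin n → ℝ)) (g : Fin n → Scal n) (h : Scal n) : Prop :=
  ∀ u ∈ U, ∀ i j, i ≠ j →
    pd i (pd j h) u = logLame g i j u * pd i h u + logLame g j i u * pd j h u

theorem sum_christoffel_mul (g : Fin n → Scal n) {i j : Fin n} (hij : i ≠ j) (F : Fin n → ℝ) :
    ∑ m, christoffel g m i j u * F m = logLame g i j u * F i + logLame g j i u * F j := by
  rw [sum_eq_pair_add_compl hij, christoffel_self_left, christoffel_self_right,
    Finset.sum_eq_zero, add_zero]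
  intro m hm
  obtain ⟨hmi, hmj⟩ := mem_compl_pair.1 hm
  rw [christoffel_of_ne g hmi hmj hij, zero_mul]

theorem hasDiagHess_of_hess_eq_zero (hg : IsDiagMetric U g) {h : Scal n}
    (hh : ∀ u ∈ U, ∀ i j, i ≠ j → hess g h i j u = 0) : HasDiagHess U g h := by
  intro u hu i j hij
  have h0 := hh u hu i j hij
  rw [hess, sum_christoffel_mul g hij fun m => pd m h u] at h0
  have := (mul_eq_zero.1 h0).resolve_left (inv_ne_zero ((hg i).2 u hu))
  linarith

theorem IsDiagMetric.hess_eq (hg : IsDiagMetric U g) (hu : u ∈ U) (h : Scal n) {i j : Fin n}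
    (hij : i ≠ j) :
    hess g h i i u = (g i u)⁻¹ * (pd i (pd i h) u - logLame g i i u * pd i h u) +
      (g j u)⁻¹ * (logLame g i j u * pd j h u) +
      ∑ m ∈ ({i, j}ᶜ : Finset (Fin n)), (g m u)⁻¹ * (logLame g i m u * pd m h u) := by
  have hi0 := (hg i).2 u hu
  have h3 : ∑ m ∈ ({i, j}ᶜ : Finset (Fin n)), christoffel g m i i u * pd m h u =
      -(g i u * ∑ m ∈ ({i, j}ᶜ : Finset (Fin n)), (g m u)⁻¹ * (logLame g i m u * pd m h u)) := by
    rw [Finset.mul_sum, ← Finset.sum_neg_distrib]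
    refine Finset.sum_congr rfl fun m hm => ?_
    rw [christoffel_diag g (mem_compl_pair.1 hm).1 hi0]
    ring
  rw [hess, sum_eq_pair_add_compl hij, h3, christoffel_self_left, christoffel_diag g hij.symm hi0]
  field_simp
  ring

theorem IsDiagMetric.contDiffOn_hess (hU : IsOpen U) (hg : IsDiagMetric U g) {h : Scal n}
    (hh : ContDiffOn ℝ ∞ h U) {i j : Fin n} (hij : i ≠ j) :
    ContDiffOn ℝ ∞ (hess g h i i) U := by
  have hd := fun m => contDiffOn_pd hU hh m
  have hL := fun i j => hg.contDiffOn_logLame hU i j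
  refine ContDiffOn.congr (f := fun u =>
    (g i u)⁻¹ * (pd i (pd i h) u - logLame g i i u * pd i h u) +
      (g j u)⁻¹ * (logLame g i j u * pd j h u) +
      ∑ m ∈ ({i, j}ᶜ : Finset (Fin n)), (g m u)⁻¹ * (logLame g i m u * pd m h u))
    ?_ fun u hu => hg.hess_eq hu h hij
  refine (((hg.contDiffOn_inv i).mul ((contDiffOn_pd hU (hd i) i).sub ((hL i i).mul (hd i)))).add
    ((hg.contDiffOn_inv j).mul ((hL i j).mul (hd j)))).add ?_
  exact ContDiffOn.sum fun m _ => (hg.contDiffOn_inv m).mul ((hL i m).mul (hd m))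

/-- The Ricci identity for a function with diagonal Hessian: the failure of the eigenvalues of the
Hessian to form an affinor is measured by the sectional curvatures. -/
theorem IsDiagMetric.hasPd_hess (hU : IsOpen U) (hg : IsDiagMetric U g)
    (hs : IsSemiHamiltonian U g) {h : Scal n} (hh : ContDiffOn ℝ ∞ h U) (hd : HasDiagHess U g h)
    (hu : u ∈ U) {i j : Fin n} (hij : i ≠ j) :
    HasPd j (hess g h i i)
      ((hess g h j j u - hess g h i i u) * logLame g i j u - curv g i j i j u * pd j h u) u := by
  have hP := fun m => contDiffOn_pd hU hh m
  have hL := fun i j => hg.contDiffOn_logLame hU i j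
  have hPd := fun m k => hasPd_of_contDiffOn hU (hP m) hu k
  have hLd := fun i j k => hasPd_of_contDiffOn hU (hL i j) hu k
  -- `∂_j ∂_i² h` is the `i`-th derivative of the formula for `∂_i ∂_j h`
  have h3 : pd j (pd i (pd i h)) u =
      logLame g i j u * pd i (pd i h) u + pd i (logLame g i j) u * pd i h u +
      (logLame g j i u * pd i (pd j h) u + pd i (logLame g j i) u * pd j h u) := by
    rw [pd_comm hU (hP i) hu j i]
    refine ((((hLd i j i).mul (hPd i i)).add ((hLd j i i).mul (hPd j i))).congr_of_eqOn
      hU hu fun u hu => ?_).pd_eq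
    rw [pd_comm hU hh hu j i, hd u hu i j hij]
  have hsum := HasPd.sum (i := j) (u := u) (s := ({i, j}ᶜ : Finset (Fin n)))
    (F := fun m u => (g m u)⁻¹ * (logLame g i m u * pd m h u))
    fun m _ => (hg.hasPd_inv hU hu m j).mul ((hLd i m j).mul (hPd m j))
  have htot := ((((hg.hasPd_inv hU hu i j).mul
    ((hasPd_of_contDiffOn hU (contDiffOn_pd hU (hP i) i) hu j).sub ((hLd i i j).mul (hPd i j)))).add
    ((hg.hasPd_inv hU hu j j).mul ((hLd i j j).mul (hPd j j)))).add hsum).congr_of_eqOn hU hu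
      fun u hu => hg.hess_eq hu h hij
  refine htot.congr_deriv ?_
  have hS : ∑ m ∈ ({i, j}ᶜ : Finset (Fin n)),
      ((g m u)⁻¹ * (logLame g i m u * pd j (pd m h) u + pd j (logLame g i m) u * pd m h u) +
        -2 * (g m u)⁻¹ * logLame g m j u * (logLame g i m u * pd m h u)) =
      logLame g i j u * ∑ m ∈ ({i, j}ᶜ : Finset (Fin n)),
          (g m u)⁻¹ * (logLame g j m u * pd m h u) -
        logLame g i j u * ∑ m ∈ ({i, j}ᶜ : Finset (Fin n)),
          (g m u)⁻¹ * (logLame g i m u * pd m h u) +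
        (∑ m ∈ ({i, j}ᶜ : Finset (Fin n)),
          (g m u)⁻¹ * (logLame g i m u * logLame g j m u)) * pd j h u := by
    rw [Finset.mul_sum, Finset.mul_sum, Finset.sum_mul, ← Finset.sum_sub_distrib,
      ← Finset.sum_add_distrib]
    refine Finset.sum_congr rfl fun m hm => ?_
    obtain ⟨hmi, hmj⟩ := mem_compl_pair.1 hm
    rw [hs u hu i m j hmi.symm hij hmj, hd u hu j m hmj.symm]
    ring
  rw [hS, h3, hg.curv_eq hU hu hij, hg.hess_eq hu h hij, hg.hess_eq hu h hij.symm,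
    Finset.pair_comm j i, hg.pd_logLame_comm hU hu i j i, pd_comm hU hh hu j i, hd u hu i j hij]
  ring

/-- The scalar product `(∇ h, ∇ k)` of two gradients. -/
def gradInner (g : Fin n → Scal n) (h k : Scal n) : Scal n :=
  fun u => ∑ m, (g m u)⁻¹ * (pd m h u * pd m k u)

theorem IsDiagMetric.contDiffOn_gradInner (hU : IsOpen U) (hg : IsDiagMetric U g) {h k : Scal n}
    (hh : ContDiffOn ℝ ∞ h U) (hk : ContDiffOn ℝ ∞ k U) : ContDiffOn ℝ ∞ (gradInner g h k) U :=
  ContDiffOn.sum fun m _ =>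
    (hg.contDiffOn_inv m).mul ((contDiffOn_pd hU hh m).mul (contDiffOn_pd hU hk m))

theorem IsDiagMetric.hasPd_gradInner (hU : IsOpen U) (hg : IsDiagMetric U g) {h k : Scal n}
    (hh : ContDiffOn ℝ ∞ h U) (hk : ContDiffOn ℝ ∞ k U) (hdh : HasDiagHess U g h)
    (hdk : HasDiagHess U g k) (hu : u ∈ U) {i j : Fin n} (hij : i ≠ j) :
    HasPd j (gradInner g h k)
      (hess g h j j u * pd j k u + hess g k j j u * pd j h u) u := by
  have hsum := HasPd.sum (i := j) (u := u) (s := Finset.univ)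
    (F := fun m u => (g m u)⁻¹ * (pd m h u * pd m k u))
    fun m _ => (hg.hasPd_inv hU hu m j).mul
      ((hasPd_of_contDiffOn hU (contDiffOn_pd hU hh m) hu j).mul
        (hasPd_of_contDiffOn hU (contDiffOn_pd hU hk m) hu j))
  refine hsum.congr_deriv ?_
  have hS : ∑ m ∈ ({j, i}ᶜ : Finset (Fin n)),
      ((g m u)⁻¹ * (pd m h u * pd j (pd m k) u + pd j (pd m h) u * pd m k u) +
        -2 * (g m u)⁻¹ * logLame g m j u * (pd m h u * pd m k u)) =
      (∑ m ∈ ({j, i}ᶜ : Finset (Fin n)), (g m u)⁻¹ * (logLame g j m u * pd m h u)) * pd j k u +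
      (∑ m ∈ ({j, i}ᶜ : Finset (Fin n)), (g m u)⁻¹ * (logLame g j m u * pd m k u)) * pd j h u := by
    rw [Finset.sum_mul, Finset.sum_mul, ← Finset.sum_add_distrib]
    refine Finset.sum_congr rfl fun m hm => ?_
    obtain ⟨hmj, hmi⟩ := mem_compl_pair.1 hm
    rw [hdh u hu j m hmj.symm, hdk u hu j m hmj.symm]
    ring
  rw [sum_eq_pair_add_compl hij.symm, hS, hg.hess_eq hu h hij.symm, hg.hess_eq hu k hij.symm,
    hdh u hu j i hij.symm, hdk u hu j i hij.symm]
  ring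

/-- The density of a conservation law of a diagonal system whose velocities form an affinor of the
metric has diagonal Hessian. -/
theorem IsConservationLaw.hasDiagHess (hU : IsOpen U) {v : Fin n → Scal n} {h a : Scal n}
    (hv : IsStrictlyHyperbolic U v)
    (hva : ∀ u ∈ U, ∀ i j, i ≠ j → pd j (v i) u = (v j u - v i u) * logLame g i j u)
    (hc : IsConservationLaw U v h a) : HasDiagHess U g h := by
  intro u hu i j hij
  obtain ⟨hh, ha, hha⟩ := hc
  have key : ∀ i j : Fin n, pd j (pd i a) u = v i u * pd j (pd i h) u + pd j (v i) u * pd i h u :=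
    fun i j => (((hasPd_of_contDiffOn hU (hv.1 i) hu j).mul
      (hasPd_of_contDiffOn hU (contDiffOn_pd hU hh i) hu j)).congr_of_eqOn hU hu
        fun u hu => hha u hu i).pd_eq
  have h1 := pd_comm hU ha hu i j
  rw [key, key, hva u hu i j hij, hva u hu j i hij.symm, pd_comm hU hh hu j i] at h1
  have h2 : v i u - v j u ≠ 0 := sub_ne_zero.2 (hv.2 u hu i j hij)
  have h3 : (v i u - v j u) * (pd i (pd j h) u -
      (logLame g i j u * pd i h u + logLame g j i u * pd j h u)) = 0 := by
    linear_combination -h1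
  linarith [(mul_eq_zero.1 h3).resolve_left h2]

end

/-! ### Metrics of Dubrovin-Novikov systems -/

section
variable {U : Set (Fin n → ℝ)} {v g : Fin n → Scal n} {u : Fin n → ℝ}

/-- Multiplying `g_i` by a function of `u^i` alone does not change `Γ^i_{ij}` for `j ≠ i`. -/
theorem logLame_mul_coord (hU : IsOpen U) (hg : IsDiagMetric U g) {f : Fin n → ℝ → ℝ}
    (hf : ∀ i, ContDiffOn ℝ ∞ (f i) ((fun u : Fin n → ℝ => u i) '' U))
    (hf0 : ∀ i, ∀ u ∈ U, f i (u i) ≠ 0) (hu : u ∈ U) {i j : Fin n} (hij : i ≠ j) :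
    logLame (fun i u => g i u * f i (u i)) i j u = logLame g i j u := by
  have hopen : IsOpen ((fun u : Fin n → ℝ => u i) '' U) := isOpenMap_eval i U hU
  have hfd : DifferentiableAt ℝ (f i) (u i) :=
    ((hf i).contDiffAt (hopen.mem_nhds ⟨u, hu, rfl⟩)).differentiableAt (by simp)
  have hproj : HasFDerivAt (fun u : Fin n → ℝ => u i)
      (ContinuousLinearMap.proj (R := ℝ) (φ := fun _ : Fin n => ℝ) i) u := hasFDerivAt_apply i u
  have h1 : HasPd j (fun u : Fin n → ℝ => f i (u i)) 0 u :=
    (HasPd.of_hasFDerivAt (hfd.hasFDerivAt.comp u hproj)).congr_deriv (by simp [hij])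
  have h2 := ((hasPd_of_contDiffOn hU (hg i).1 hu j).mul h1).pd_eq
  simp only [logLame]
  rw [h2]
  have := (hg i).2 u hu
  have := hf0 i u hu
  field_simp
  ring

theorem IsMetricOfDNSystem.isSemiHamiltonian (hU : IsOpen U) (h : IsMetricOfDNSystem U v g) :
    IsSemiHamiltonian U g := by
  obtain ⟨hg, f, hf, hf0, hflat, -⟩ := h
  have hl : ∀ u ∈ U, ∀ i j, i ≠ j →
      logLame (fun i u => g i u * f i (u i)) i j u = logLame g i j u :=
    fun u hu i j hij => logLame_mul_coord hU hg hf hf0 hu hij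
  intro u hu i j k hij hik hjk
  have h1 := hflat.isSemiHamiltonian hU u hu i j k hij hik hjk
  rwa [pd_congr hU hu (fun u hu => hl u hu i j hij) k, hl u hu i j hij, hl u hu i k hik,
    hl u hu k j hjk.symm, hl u hu j k hjk] at h1

/-- The velocities of a Dubrovin-Novikov system are the eigenvalues of the Hessian of a function
with diagonal Hessian on a flat space; by the Ricci identity they form an affinor. -/
theorem IsMetricOfDNSystem.pd_velocity (hU : IsOpen U) (h : IsMetricOfDNSystem U v g)
    (hu : u ∈ U) {i j : Fin n} (hij : i ≠ j) :
    pd j (v i) u = (v j u - v i u) * logLame g i j u := by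
  obtain ⟨hg, f, hf, hf0, hflat, H, hH, hHv⟩ := h
  have hd : HasDiagHess U (fun i u => g i u * f i (u i)) H :=
    hasDiagHess_of_hess_eq_zero hflat.1 fun u hu i j hij => by rw [hHv u hu, if_neg hij]
  have hdiag : ∀ u ∈ U, ∀ i, hess (fun i u => g i u * f i (u i)) H i i u = v i u :=
    fun u hu i => by rw [hHv u hu, if_pos rfl]
  have h1 := (hflat.1.hasPd_hess hU (hflat.isSemiHamiltonian hU) hH hd hu hij).congr_of_eqOn
    (f' := v i) hU hu fun u hu => (hdiag u hu i).symm
  rw [h1.pd_eq, hflat.curv_eq_zero hu, hdiag u hu, hdiag u hu,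
    logLame_mul_coord hU hg hf hf0 hu hij]
  ring

/-! ### Curvature of reciprocal metrics -/

/-- The curvature of `ĝ_j = α_j² g_j`, where `α_j` and a companion family `γ_j` have the
derivatives that they have for the conformal factors of a reciprocal transformation generated by
two conserved densities `B` and `N`. In terms of rotation coefficients,
`β̂_{ij} = β_{ij} - H_j (α_j ∂_i B + γ_j ∂_i N) / H_i`. -/
theorem curv_eq_of_rescaled (hU : IsOpen U) (hg : IsDiagMetric U g) {B N : Scal n}
    (hB : ContDiffOn ℝ ∞ B U) (hN : ContDiffOn ℝ ∞ N U) {α γ : Fin n → Scal n}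
    (hα : ∀ i, ContDiffOn ℝ ∞ (α i) U) (hγ : ∀ i, ContDiffOn ℝ ∞ (γ i) U)
    (hα0 : ∀ u ∈ U, ∀ i, α i u ≠ 0)
    (hαd : ∀ u ∈ U, ∀ i j, i ≠ j → pd i (α j) u =
      α i u * (logLame g j i u - (pd i B u * α j u + pd i N u * γ j u)) - α j u * logLame g j i u)
    (hγd : ∀ u ∈ U, ∀ i j, i ≠ j → pd i (γ j) u =
      γ i u * (logLame g j i u - (pd i B u * α j u + pd i N u * γ j u)) - γ j u * logLame g j i u)
    (hu : u ∈ U) {i j : Fin n} (hij : i ≠ j) :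
    curv g i j i j u = α i u * α j u * curv (fun i u => α i u ^ 2 * g i u) i j i j u -
      (α j u * hess g B i i u + γ j u * hess g N i i u +
        α i u * hess g B j j u + γ i u * hess g N j j u) +
      (α i u * α j u * gradInner g B B u + (α i u * γ j u + α j u * γ i u) * gradInner g B N u +
        γ i u * γ j u * gradInner g N N u) := by
  have hĝ : IsDiagMetric U (fun i u => α i u ^ 2 * g i u) := fun i =>
    ⟨((hα i).pow 2).mul (hg i).1, fun u hu => mul_ne_zero (pow_ne_zero 2 (hα0 u hu i))
      ((hg i).2 u hu)⟩
  have hαp := fun (u : Fin n → ℝ) (hu : u ∈ U) i k => hasPd_of_contDiffOn hU (hα i) hu k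
  have hγp := fun (u : Fin n → ℝ) (hu : u ∈ U) i k => hasPd_of_contDiffOn hU (hγ i) hu k
  -- the coefficients `Γ̂^j_{ji}` of the rescaled metric, first in general and then for `i ≠ j`
  have hL : ∀ u ∈ U, ∀ j i, logLame (fun i u => α i u ^ 2 * g i u) j i u =
      logLame g j i u + pd i (α j) u / α j u := by
    intro u hu j i
    have h1 := (((hαp u hu j i).mul (hαp u hu j i)).mul (hg.hasPd hU hu j i)).congr_of_eqOn
      (f' := fun u => α j u ^ 2 * g j u) hU hu fun u _ => by ring
    have := hα0 u hu j
    have := (hg j).2 u hu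
    simp only [logLame] at h1 ⊢
    rw [h1.pd_eq]
    field_simp
    ring
  have hL' : ∀ u ∈ U, ∀ j i, i ≠ j → logLame (fun i u => α i u ^ 2 * g i u) j i u =
      α i u * (logLame g j i u - (pd i B u * α j u + pd i N u * γ j u)) / α j u := by
    intro u hu j i hne
    have := hα0 u hu j
    rw [hL u hu j i, hαd u hu i j hne]
    field_simp
    ring
  have hBp := fun i k => hasPd_of_contDiffOn hU (contDiffOn_pd hU hB i) hu k
  have hNp := fun i k => hasPd_of_contDiffOn hU (contDiffOn_pd hU hN i) hu k
  -- each of the two first summands of the curvature formula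
  have hterm : ∀ i j, i ≠ j →
      pd i (logLame (fun i u => α i u ^ 2 * g i u) j i) u +
        logLame (fun i u => α i u ^ 2 * g i u) j i u ^ 2 -
        logLame (fun i u => α i u ^ 2 * g i u) i i u *
          logLame (fun i u => α i u ^ 2 * g i u) j i u =
      α i u / α j u * (pd i (logLame g j i) u + logLame g j i u ^ 2 -
          logLame g i i u * logLame g j i u -
        (α j u * (pd i (pd i B) u - logLame g i i u * pd i B u) +
          γ j u * (pd i (pd i N) u - logLame g i i u * pd i N u) +
          (pd i B u * α i u + pd i N u * γ i u) *
            (logLame g j i u - (pd i B u * α j u + pd i N u * γ j u)))) := by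
    intro i j hne
    have hαi := hα0 u hu i
    have hαj := hα0 u hu j
    have h1 := (((hαp u hu i i).mul
      ((hasPd_of_contDiffOn hU (hg.contDiffOn_logLame hU j i) hu i).sub
        (((hBp i i).mul (hαp u hu j i)).add ((hNp i i).mul (hγp u hu j i))))).div
      (hαp u hu j i) hαj).congr_of_eqOn hU hu fun u hu => hL' u hu j i hne
    rw [h1.pd_eq, hL' u hu j i hne, hL u hu i i, hαd u hu i j hne, hγd u hu i j hne]
    field_simp
    ring
  have hS : ∑ m ∈ ({i, j}ᶜ : Finset (Fin n)), (α m u ^ 2 * g m u)⁻¹ *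
      (logLame (fun i u => α i u ^ 2 * g i u) i m u *
        logLame (fun i u => α i u ^ 2 * g i u) j m u) =
      (α i u)⁻¹ * (α j u)⁻¹ * ∑ m ∈ ({i, j}ᶜ : Finset (Fin n)), (g m u)⁻¹ *
        ((logLame g i m u - (pd m B u * α i u + pd m N u * γ i u)) *
          (logLame g j m u - (pd m B u * α j u + pd m N u * γ j u))) := by
    rw [Finset.mul_sum]
    refine Finset.sum_congr rfl fun m hm => ?_
    obtain ⟨hmi, hmj⟩ := mem_compl_pair.1 hm
    have := hα0 u hu m
    have := hα0 u hu i
    have := hα0 u hu j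
    have := (hg m).2 u hu
    rw [hL' u hu i m hmi, hL' u hu j m hmj]
    field_simp
  have hαi := hα0 u hu i
  have hαj := hα0 u hu j
  have hĉ : α i u * α j u * curv (fun i u => α i u ^ 2 * g i u) i j i j u = _ :=
    congrArg (α i u * α j u * ·) (hĝ.curv_eq hU hu hij)
  rw [hterm i j hij, hterm j i hij.symm, hS] at hĉ
  -- the sum over `m ≠ i, j`, expanded
  have hS' : ∑ m ∈ ({i, j}ᶜ : Finset (Fin n)), (g m u)⁻¹ *
        ((logLame g i m u - (pd m B u * α i u + pd m N u * γ i u)) *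
          (logLame g j m u - (pd m B u * α j u + pd m N u * γ j u))) =
      ∑ m ∈ ({i, j}ᶜ : Finset (Fin n)), (g m u)⁻¹ * (logLame g i m u * logLame g j m u) -
      α i u * ∑ m ∈ ({i, j}ᶜ : Finset (Fin n)), (g m u)⁻¹ * (logLame g j m u * pd m B u) -
      γ i u * ∑ m ∈ ({i, j}ᶜ : Finset (Fin n)), (g m u)⁻¹ * (logLame g j m u * pd m N u) -
      α j u * ∑ m ∈ ({i, j}ᶜ : Finset (Fin n)), (g m u)⁻¹ * (logLame g i m u * pd m B u) -
      γ j u * ∑ m ∈ ({i, j}ᶜ : Finset (Fin n)), (g m u)⁻¹ * (logLame g i m u * pd m N u) +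
      α i u * α j u * ∑ m ∈ ({i, j}ᶜ : Finset (Fin n)), (g m u)⁻¹ * (pd m B u * pd m B u) +
      (α i u * γ j u + α j u * γ i u) *
        ∑ m ∈ ({i, j}ᶜ : Finset (Fin n)), (g m u)⁻¹ * (pd m B u * pd m N u) +
      γ i u * γ j u * ∑ m ∈ ({i, j}ᶜ : Finset (Fin n)), (g m u)⁻¹ * (pd m N u * pd m N u) := by
    simp only [Finset.mul_sum, ← Finset.sum_sub_distrib, ← Finset.sum_add_distrib]
    exact Finset.sum_congr rfl fun m _ => by ring
  rw [hS'] at hĉ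
  rw [hĉ, hg.curv_eq hU hu hij, hg.hess_eq hu B hij, hg.hess_eq hu B hij.symm,
    hg.hess_eq hu N hij, hg.hess_eq hu N hij.symm, gradInner, gradInner, gradInner,
    sum_eq_pair_add_compl hij, sum_eq_pair_add_compl hij, sum_eq_pair_add_compl hij,
    Finset.pair_comm j i]
  have := (hg i).2 u hu
  have := (hg j).2 u hu
  field_simp
  ring

end

section
variable {U : Set (Fin n → ℝ)} {v g : Fin n → Scal n} {u : Fin n → ℝ} {B A N M : Scal n}

theorem IsConservationLaw.hasPd (hU : IsOpen U) (h : IsConservationLaw U v B A) (hu : u ∈ U)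
    (i : Fin n) : HasPd i A (v i u * pd i B u) u :=
  (hasPd_of_contDiffOn hU h.2.1 hu i).congr_deriv (h.2.2 u hu i)

theorem IsReciprocal.contDiffOn_det (h : IsReciprocal U v B A N M) :
    ContDiffOn ℝ ∞ (fun u => B u * M u - A u * N u) U :=
  (h.1.1.mul h.2.1.2.1).sub (h.1.2.1.mul h.2.1.1)

/-- The curvature of `g` when the reciprocal metric is flat, in terms of the Hessians of the two
generating densities. -/
theorem IsReciprocal.curv_eq (hU : IsOpen U) (hg : IsDiagMetric U g)
    (hv : ∀ i, ContDiffOn ℝ ∞ (v i) U)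
    (hva : ∀ u ∈ U, ∀ i j, i ≠ j → pd j (v i) u = (v j u - v i u) * logLame g i j u)
    (hrec : IsReciprocal U v B A N M) (hflat : IsFlatMetric U (recMetric v g B A N M))
    (hu : u ∈ U) {i j : Fin n} (hij : i ≠ j) {α γ : Fin n → Scal n}
    (hαdef : α = fun i u => (M u - N u * v i u) / (B u * M u - A u * N u))
    (hγdef : γ = fun i u => (B u * v i u - A u) / (B u * M u - A u * N u)) :
    curv g i j i j u =
      -(α j u * hess g B i i u + γ j u * hess g N i i u +
        α i u * hess g B j j u + γ i u * hess g N j j u) +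
      (α i u * α j u * gradInner g B B u + (α i u * γ j u + α j u * γ i u) * gradInner g B N u +
        γ i u * γ j u * gradInner g N N u) := by
  have hD := hrec.2.2
  have hα : ∀ i, ContDiffOn ℝ ∞ (α i) U := fun i => by
    rw [hαdef]
    exact (hrec.2.1.2.1.sub (hrec.2.1.1.mul (hv i))).div hrec.contDiffOn_det hD
  have hγ : ∀ i, ContDiffOn ℝ ∞ (γ i) U := fun i => by
    rw [hγdef]
    exact ((hrec.1.1.mul (hv i)).sub hrec.1.2.1).div hrec.contDiffOn_det hD
  have hrm : recMetric v g B A N M = fun i u => α i u ^ 2 * g i u := by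
    rw [hαdef]; rfl
  rw [hrm] at hflat
  have hα0 : ∀ u ∈ U, ∀ i, α i u ≠ 0 := fun u hu i h0 =>
    (hflat.1 i).2 u hu (by simp [h0])
  have hBp := fun (u : Fin n → ℝ) (hu : u ∈ U) i => hasPd_of_contDiffOn hU hrec.1.1 hu i
  have hNp := fun (u : Fin n → ℝ) (hu : u ∈ U) i => hasPd_of_contDiffOn hU hrec.2.1.1 hu i
  have hAp := fun (u : Fin n → ℝ) (hu : u ∈ U) i => hrec.1.hasPd hU hu i
  have hMp := fun (u : Fin n → ℝ) (hu : u ∈ U) i => hrec.2.1.hasPd hU hu i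
  have hvp := fun (u : Fin n → ℝ) (hu : u ∈ U) i j (hij : i ≠ j) =>
    (hasPd_of_contDiffOn hU (hv i) hu j).congr_deriv (hva u hu i j hij)
  have hαd : ∀ u ∈ U, ∀ i j, i ≠ j → pd i (α j) u =
      α i u * (logLame g j i u - (pd i B u * α j u + pd i N u * γ j u)) -
        α j u * logLame g j i u := by
    intro u hu i j hij
    have h1 := (((hMp u hu i).sub ((hNp u hu i).mul (hvp u hu j i hij.symm))).div
      (((hBp u hu i).mul (hMp u hu i)).sub ((hAp u hu i).mul (hNp u hu i))) (hD u hu)).pd_eq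
    have hDu := hD u hu
    simp only [hαdef, hγdef]
    rw [h1]
    generalize hDe : B u * M u - A u * N u = D at hDu ⊢
    field_simp
    rw [← hDe]
    ring
  have hγd : ∀ u ∈ U, ∀ i j, i ≠ j → pd i (γ j) u =
      γ i u * (logLame g j i u - (pd i B u * α j u + pd i N u * γ j u)) -
        γ j u * logLame g j i u := by
    intro u hu i j hij
    have h1 := ((((hBp u hu i).mul (hvp u hu j i hij.symm)).sub (hAp u hu i)).div
      (((hBp u hu i).mul (hMp u hu i)).sub ((hAp u hu i).mul (hNp u hu i))) (hD u hu)).pd_eq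
    have hDu := hD u hu
    simp only [hαdef, hγdef]
    rw [h1]
    generalize hDe : B u * M u - A u * N u = D at hDu ⊢
    field_simp
    rw [← hDe]
    ring
  rw [curv_eq_of_rescaled hU hg hrec.1.1 hrec.2.1.1 hα hγ hα0 hαd hγd hu hij,
    hflat.curv_eq_zero hu]
  ring

/-! ### Affinors of a metric with flat reciprocal metric -/

/-- Velocities `w₁`, `w₂` that satisfy the curvature condition, together with functions `p`, `q`,
`r`, `s` such that the flows of `B` and `N` vanish when `-p`, `-q` and `-r`, `-s` are taken for the
fluxes along `w₁`, `w₂`. In general `w₁`, `w₂` are not affinors: they can be replaced by `w₁ - c v`,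
`w₂ + c` with a function `c`, which has yet to be chosen. -/
structure CurvatureData (U : Set (Fin n → ℝ)) (v g : Fin n → Scal n) (B A N M : Scal n)
    (w₁ w₂ : Fin n → Scal n) (p q r s : Scal n) : Prop where
  smooth_w₁ : ∀ i, ContDiffOn ℝ ∞ (w₁ i) U
  smooth_w₂ : ∀ i, ContDiffOn ℝ ∞ (w₂ i) U
  smooth_p : ContDiffOn ℝ ∞ p U
  smooth_q : ContDiffOn ℝ ∞ q U
  smooth_r : ContDiffOn ℝ ∞ r U
  smooth_s : ContDiffOn ℝ ∞ s U
  inner_BB : ∀ u ∈ U, B u * p u + A u * q u = 1 / 2 * gradInner g B B u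
  inner_BN : ∀ u ∈ U, N u * p u + M u * q u = 1 / 2 * gradInner g B N u
  inner_NB : ∀ u ∈ U, B u * r u + A u * s u = 1 / 2 * gradInner g B N u
  inner_NN : ∀ u ∈ U, N u * r u + M u * s u = 1 / 2 * gradInner g N N u
  flow_B : ∀ u ∈ U, ∀ i,
    B u * w₁ i u + A u * w₂ i u = p u + q u * v i u - hess g B i i u
  flow_N : ∀ u ∈ U, ∀ i,
    N u * w₁ i u + M u * w₂ i u = r u + s u * v i u - hess g N i i u
  curvature : HasSpecialCurvature U v g w₁ w₂

theorem exists_curvatureData (hn : 2 ≤ n) (hU : IsOpen U) (hg : IsDiagMetric U g)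
    (hv : ∀ i, ContDiffOn ℝ ∞ (v i) U)
    (hva : ∀ u ∈ U, ∀ i j, i ≠ j → pd j (v i) u = (v j u - v i u) * logLame g i j u)
    (hrec : IsReciprocal U v B A N M) (hflat : IsFlatMetric U (recMetric v g B A N M)) :
    ∃ (w₁ w₂ : Fin n → Scal n) (p q r s : Scal n),
      CurvatureData U v g B A N M w₁ w₂ p q r s := by
  have : Nontrivial (Fin n) := Fin.nontrivial_iff_two_le.2 hn
  have hD := hrec.2.2
  have hDc := hrec.contDiffOn_det
  have hD2 : ∀ u ∈ U, 2 * (B u * M u - A u * N u) ≠ 0 := fun u hu =>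
    mul_ne_zero two_ne_zero (hD u hu)
  have hD2c : ContDiffOn ℝ ∞ (fun u => 2 * (B u * M u - A u * N u)) U :=
    contDiffOn_const.mul hDc
  have hB := hrec.1.1
  have hA := hrec.1.2.1
  have hN := hrec.2.1.1
  have hM := hrec.2.1.2.1
  have hX := fun {h k : Scal n} (hh : ContDiffOn ℝ ∞ h U) (hk : ContDiffOn ℝ ∞ k U) =>
    hg.contDiffOn_gradInner hU hh hk
  have hH : ∀ {h : Scal n}, ContDiffOn ℝ ∞ h U → ∀ i, ContDiffOn ℝ ∞ (hess g h i i) U :=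
    fun hh i => by
      obtain ⟨j, hj⟩ := exists_ne i
      exact hg.contDiffOn_hess hU hh hj.symm
  -- the solutions of the linear systems by Cramer's rule
  set p : Scal n := fun u => (M u * gradInner g B B u - A u * gradInner g B N u) /
    (2 * (B u * M u - A u * N u)) with hp
  set q : Scal n := fun u => (B u * gradInner g B N u - N u * gradInner g B B u) /
    (2 * (B u * M u - A u * N u)) with hq
  set r : Scal n := fun u => (M u * gradInner g B N u - A u * gradInner g N N u) /
    (2 * (B u * M u - A u * N u)) with hr
  set s : Scal n := fun u => (B u * gradInner g N N u - N u * gradInner g B N u) /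
    (2 * (B u * M u - A u * N u)) with hs
  have hpc : ContDiffOn ℝ ∞ p U := ((hM.mul (hX hB hB)).sub (hA.mul (hX hB hN))).div hD2c hD2
  have hqc : ContDiffOn ℝ ∞ q U := ((hB.mul (hX hB hN)).sub (hN.mul (hX hB hB))).div hD2c hD2
  have hrc : ContDiffOn ℝ ∞ r U := ((hM.mul (hX hB hN)).sub (hA.mul (hX hN hN))).div hD2c hD2
  have hsc : ContDiffOn ℝ ∞ s U := ((hB.mul (hX hN hN)).sub (hN.mul (hX hB hN))).div hD2c hD2
  have eBB : ∀ u ∈ U, B u * p u + A u * q u = 1 / 2 * gradInner g B B u := fun u hu => by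
    have := hD u hu
    simp only [hp, hq]
    generalize hDe : B u * M u - A u * N u = D at this ⊢
    field_simp
    rw [← hDe]
    ring
  have eBN : ∀ u ∈ U, N u * p u + M u * q u = 1 / 2 * gradInner g B N u := fun u hu => by
    have := hD u hu
    simp only [hp, hq]
    generalize hDe : B u * M u - A u * N u = D at this ⊢
    field_simp
    rw [← hDe]
    ring
  have eNB : ∀ u ∈ U, B u * r u + A u * s u = 1 / 2 * gradInner g B N u := fun u hu => by
    have := hD u hu
    simp only [hr, hs]
    generalize hDe : B u * M u - A u * N u = D at this ⊢
    field_simp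
    rw [← hDe]
    ring
  have eNN : ∀ u ∈ U, N u * r u + M u * s u = 1 / 2 * gradInner g N N u := fun u hu => by
    have := hD u hu
    simp only [hr, hs]
    generalize hDe : B u * M u - A u * N u = D at this ⊢
    field_simp
    rw [← hDe]
    ring
  clear_value p q r s
  set y₁ : Fin n → Scal n := fun i u => p u + q u * v i u - hess g B i i u with hy₁
  set y₂ : Fin n → Scal n := fun i u => r u + s u * v i u - hess g N i i u with hy₂
  have hy₁c : ∀ i, ContDiffOn ℝ ∞ (y₁ i) U := fun i => (hpc.add (hqc.mul (hv i))).sub (hH hB i)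
  have hy₂c : ∀ i, ContDiffOn ℝ ∞ (y₂ i) U := fun i => (hrc.add (hsc.mul (hv i))).sub (hH hN i)
  set w₁ : Fin n → Scal n := fun i u =>
    (M u * y₁ i u - A u * y₂ i u) / (B u * M u - A u * N u) with hw₁
  set w₂ : Fin n → Scal n := fun i u =>
    (B u * y₂ i u - N u * y₁ i u) / (B u * M u - A u * N u) with hw₂
  have hw₁c : ∀ i, ContDiffOn ℝ ∞ (w₁ i) U := fun i =>
    ((hM.mul (hy₁c i)).sub (hA.mul (hy₂c i))).div hDc hD
  have hw₂c : ∀ i, ContDiffOn ℝ ∞ (w₂ i) U := fun i =>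
    ((hB.mul (hy₂c i)).sub (hN.mul (hy₁c i))).div hDc hD
  have eB : ∀ u ∈ U, ∀ i, B u * w₁ i u + A u * w₂ i u = y₁ i u := fun u hu i => by
    have := hD u hu
    simp only [hw₁, hw₂]
    generalize hDe : B u * M u - A u * N u = D at this ⊢
    field_simp
    rw [← hDe]
    ring
  have eN : ∀ u ∈ U, ∀ i, N u * w₁ i u + M u * w₂ i u = y₂ i u := fun u hu i => by
    have := hD u hu
    simp only [hw₁, hw₂]
    generalize hDe : B u * M u - A u * N u = D at this ⊢
    field_simp
    rw [← hDe]
    ring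
  clear_value w₁ w₂
  refine ⟨w₁, w₂, p, q, r, s, hw₁c, hw₂c, hpc, hqc, hrc, hsc, eBB, eBN, eNB, eNN, eB, eN, ?_⟩
  intro u hu i j hij
  obtain ⟨α, hα⟩ : ∃ α : Fin n → Scal n,
    α = fun i u => (M u - N u * v i u) / (B u * M u - A u * N u) := ⟨_, rfl⟩
  obtain ⟨γ, hγ⟩ : ∃ γ : Fin n → Scal n,
    γ = fun i u => (B u * v i u - A u) / (B u * M u - A u * N u) := ⟨_, rfl⟩
  have h1 : ∀ i, B u * α i u + N u * γ i u = 1 := fun i => by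
    have := hD u hu
    simp only [hα, hγ]
    generalize hDe : B u * M u - A u * N u = D at this ⊢
    field_simp
    rw [← hDe]
    ring
  have h2 : ∀ i, A u * α i u + M u * γ i u = v i u := fun i => by
    have := hD u hu
    simp only [hα, hγ]
    generalize hDe : B u * M u - A u * N u = D at this ⊢
    field_simp
    rw [← hDe]
    ring
  rw [hrec.curv_eq hU hg hv hva hflat hu hij hα hγ]
  have e1 := eBB u hu
  have e2 := eBN u hu
  have e3 := eNB u hu
  have e4 := eNN u hu
  -- `α_i |∇B|² + γ_i (∇B, ∇N) = 2 (p + q v_i)` and similarly for `r`, `s`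
  have e5 : ∀ i, α i u * gradInner g B B u + γ i u * gradInner g B N u =
      2 * (p u + q u * v i u) := fun i => by
    linear_combination -2 * α i u * e1 - 2 * γ i u * e2 + 2 * p u * h1 i + 2 * q u * h2 i
  have e6 : ∀ i, α i u * gradInner g B N u + γ i u * gradInner g N N u =
      2 * (r u + s u * v i u) := fun i => by
    linear_combination -2 * α i u * e3 - 2 * γ i u * e4 + 2 * r u * h1 i + 2 * s u * h2 i
  have e7 := fun i => eB u hu i
  have e8 := fun i => eN u hu i
  simp only [hy₁, hy₂] at e7 e8
  linear_combination 1 / 2 * α j u * e5 i + 1 / 2 * α i u * e5 j + 1 / 2 * γ j u * e6 i +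
    1 / 2 * γ i u * e6 j - α j u * e7 i - α i u * e7 j - γ j u * e8 i - γ i u * e8 j +
    w₁ i u * h1 j + w₂ i u * h2 j + w₁ j u * h1 i + w₂ j u * h2 i

/-- The deviation of `w₁`, `w₂` from affinors is `ε_j v^i`, `-ε_j`, where the `ε_j` also measure
the deviation of `-p`, `-q` and `-r`, `-s` from being fluxes of `B` and `N`. -/
structure CurvatureData.Defect (U : Set (Fin n → ℝ)) (v g : Fin n → Scal n) (B A N M : Scal n)
    (w₁ w₂ : Fin n → Scal n) (p q r s : Scal n) (ε : Fin n → Scal n) : Prop where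
  smooth : ∀ j, ContDiffOn ℝ ∞ (ε j) U
  pd_p : ∀ u ∈ U, ∀ j, pd j p u = -(w₁ j u * pd j B u) - A u * ε j u
  pd_q : ∀ u ∈ U, ∀ j, pd j q u = -(w₂ j u * pd j B u) + B u * ε j u
  pd_r : ∀ u ∈ U, ∀ j, pd j r u = -(w₁ j u * pd j N u) - M u * ε j u
  pd_s : ∀ u ∈ U, ∀ j, pd j s u = -(w₂ j u * pd j N u) + N u * ε j u
  pd_w₁ : ∀ u ∈ U, ∀ i j, i ≠ j →
    pd j (w₁ i) u = (w₁ j u - w₁ i u) * logLame g i j u + ε j u * v i u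
  pd_w₂ : ∀ u ∈ U, ∀ i j, i ≠ j →
    pd j (w₂ i) u = (w₂ j u - w₂ i u) * logLame g i j u - ε j u

theorem CurvatureData.exists_defect (hn : 2 ≤ n) (hU : IsOpen U) (hg : IsDiagMetric U g)
    (hsemi : IsSemiHamiltonian U g) (hv : IsStrictlyHyperbolic U v)
    (hva : ∀ u ∈ U, ∀ i j, i ≠ j → pd j (v i) u = (v j u - v i u) * logLame g i j u)
    (hrec : IsReciprocal U v B A N M) {w₁ w₂ : Fin n → Scal n} {p q r s : Scal n}
    (hw : CurvatureData U v g B A N M w₁ w₂ p q r s) :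
    ∃ ε : Fin n → Scal n, Defect U v g B A N M w₁ w₂ p q r s ε := by
  have : Nontrivial (Fin n) := Fin.nontrivial_iff_two_le.2 hn
  have hD := hrec.2.2
  have hB := hrec.1.1
  have hN := hrec.2.1.1
  have hdB := hrec.1.hasDiagHess hU hv hva
  have hdN := hrec.2.1.hasDiagHess hU hv hva
  have hBp := fun (u : Fin n → ℝ) (hu : u ∈ U) i => hasPd_of_contDiffOn hU hB hu i
  have hNp := fun (u : Fin n → ℝ) (hu : u ∈ U) i => hasPd_of_contDiffOn hU hN hu i
  have hAp := fun (u : Fin n → ℝ) (hu : u ∈ U) i => hrec.1.hasPd hU hu i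
  have hMp := fun (u : Fin n → ℝ) (hu : u ∈ U) i => hrec.2.1.hasPd hU hu i
  have hpp := fun (u : Fin n → ℝ) (hu : u ∈ U) i => hasPd_of_contDiffOn hU hw.smooth_p hu i
  have hqp := fun (u : Fin n → ℝ) (hu : u ∈ U) i => hasPd_of_contDiffOn hU hw.smooth_q hu i
  have hrp := fun (u : Fin n → ℝ) (hu : u ∈ U) i => hasPd_of_contDiffOn hU hw.smooth_r hu i
  have hsp := fun (u : Fin n → ℝ) (hu : u ∈ U) i => hasPd_of_contDiffOn hU hw.smooth_s hu i
  have hw1p := fun (u : Fin n → ℝ) (hu : u ∈ U) i j =>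
    hasPd_of_contDiffOn hU (hw.smooth_w₁ i) hu j
  have hw2p := fun (u : Fin n → ℝ) (hu : u ∈ U) i j =>
    hasPd_of_contDiffOn hU (hw.smooth_w₂ i) hu j
  -- the differentiated scalar products
  have dBB : ∀ u ∈ U, ∀ j, B u * pd j p u + A u * pd j q u + pd j B u * (p u + q u * v j u) =
      hess g B j j u * pd j B u := by
    intro u hu j
    obtain ⟨i, hij⟩ := exists_ne j
    have := (((hBp u hu j).mul (hpp u hu j)).add ((hAp u hu j).mul (hqp u hu j))).eq_of_eqOn
      ((HasPd.const (1 / 2)).mul (hg.hasPd_gradInner hU hB hB hdB hdB hu hij)) hU hu hw.inner_BB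
    linear_combination this
  have dBN : ∀ u ∈ U, ∀ j, N u * pd j p u + M u * pd j q u + pd j N u * (p u + q u * v j u) =
      1 / 2 * (hess g B j j u * pd j N u + hess g N j j u * pd j B u) := by
    intro u hu j
    obtain ⟨i, hij⟩ := exists_ne j
    have := (((hNp u hu j).mul (hpp u hu j)).add ((hMp u hu j).mul (hqp u hu j))).eq_of_eqOn
      ((HasPd.const (1 / 2)).mul (hg.hasPd_gradInner hU hB hN hdB hdN hu hij)) hU hu hw.inner_BN
    linear_combination this
  have dNB : ∀ u ∈ U, ∀ j, B u * pd j r u + A u * pd j s u + pd j B u * (r u + s u * v j u) =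
      1 / 2 * (hess g B j j u * pd j N u + hess g N j j u * pd j B u) := by
    intro u hu j
    obtain ⟨i, hij⟩ := exists_ne j
    have := (((hBp u hu j).mul (hrp u hu j)).add ((hAp u hu j).mul (hsp u hu j))).eq_of_eqOn
      ((HasPd.const (1 / 2)).mul (hg.hasPd_gradInner hU hB hN hdB hdN hu hij)) hU hu hw.inner_NB
    linear_combination this
  have dNN : ∀ u ∈ U, ∀ j, N u * pd j r u + M u * pd j s u + pd j N u * (r u + s u * v j u) =
      hess g N j j u * pd j N u := by
    intro u hu j
    obtain ⟨i, hij⟩ := exists_ne j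
    have := (((hNp u hu j).mul (hrp u hu j)).add ((hMp u hu j).mul (hsp u hu j))).eq_of_eqOn
      ((HasPd.const (1 / 2)).mul (hg.hasPd_gradInner hU hN hN hdN hdN hu hij)) hU hu hw.inner_NN
    linear_combination this
  set ε : Fin n → Scal n := fun j u =>
    (N u * (pd j p u + w₁ j u * pd j B u) + M u * (pd j q u + w₂ j u * pd j B u)) /
      (B u * M u - A u * N u) with hε
  have hεc : ∀ j, ContDiffOn ℝ ∞ (ε j) U := fun j =>
    ((hN.mul ((contDiffOn_pd hU hw.smooth_p j).add
      ((hw.smooth_w₁ j).mul (contDiffOn_pd hU hB j)))).add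
    (hrec.2.1.2.1.mul ((contDiffOn_pd hU hw.smooth_q j).add
      ((hw.smooth_w₂ j).mul (contDiffOn_pd hU hB j))))).div hrec.contDiffOn_det hD
  have hεeq : ∀ u ∈ U, ∀ j, (B u * M u - A u * N u) * ε j u =
      N u * (pd j p u + w₁ j u * pd j B u) + M u * (pd j q u + w₂ j u * pd j B u) :=
    fun u hu j => by have := hD u hu; simp only [hε]; field_simp
  clear_value ε
  have hp : ∀ u ∈ U, ∀ j, pd j p u = -(w₁ j u * pd j B u) - A u * ε j u := fun u hu j => by
    refine mul_left_cancel₀ (hD u hu) ?_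
    linear_combination A u * hεeq u hu j + M u * dBB u hu j + M u * pd j B u * hw.flow_B u hu j
  have hq : ∀ u ∈ U, ∀ j, pd j q u = -(w₂ j u * pd j B u) + B u * ε j u := fun u hu j => by
    refine mul_left_cancel₀ (hD u hu) ?_
    linear_combination -B u * hεeq u hu j - N u * dBB u hu j - N u * pd j B u * hw.flow_B u hu j
  -- the analogue of `ε` for the second density is `-ε`
  have hεeq' : ∀ u ∈ U, ∀ j, -(B u * M u - A u * N u) * ε j u =
      B u * (pd j r u + w₁ j u * pd j N u) + A u * (pd j s u + w₂ j u * pd j N u) :=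
    fun u hu j => by
      linear_combination -hεeq u hu j - dBN u hu j - dNB u hu j -
        pd j N u * hw.flow_B u hu j - pd j B u * hw.flow_N u hu j
  have hr : ∀ u ∈ U, ∀ j, pd j r u = -(w₁ j u * pd j N u) - M u * ε j u := fun u hu j => by
    refine mul_left_cancel₀ (hD u hu) ?_
    linear_combination -M u * hεeq' u hu j - A u * dNN u hu j -
      A u * pd j N u * hw.flow_N u hu j
  have hs : ∀ u ∈ U, ∀ j, pd j s u = -(w₂ j u * pd j N u) + N u * ε j u := fun u hu j => by
    refine mul_left_cancel₀ (hD u hu) ?_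
    linear_combination N u * hεeq' u hu j + B u * dNN u hu j +
      B u * pd j N u * hw.flow_N u hu j
  -- the differentiated flows
  have fB : ∀ u ∈ U, ∀ i j, i ≠ j →
      B u * (pd j (w₁ i) u - (w₁ j u - w₁ i u) * logLame g i j u) +
        A u * (pd j (w₂ i) u - (w₂ j u - w₂ i u) * logLame g i j u) =
      ε j u * (B u * v i u - A u) := by
    intro u hu i j hij
    have h1 := (((hBp u hu j).mul (hw1p u hu i j)).add
      ((hAp u hu j).mul (hw2p u hu i j))).eq_of_eqOn
        (((hpp u hu j).add ((hqp u hu j).mul (hasPd_of_contDiffOn hU (hv.1 i) hu j))).sub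
          (hg.hasPd_hess hU hsemi hB hdB hu hij)) hU hu (fun u hu => hw.flow_B u hu i)
    rw [hva u hu i j hij, hp u hu, hq u hu, hw.curvature u hu i j hij] at h1
    linear_combination h1 - logLame g i j u * (hw.flow_B u hu j - hw.flow_B u hu i)
  have fN : ∀ u ∈ U, ∀ i j, i ≠ j →
      N u * (pd j (w₁ i) u - (w₁ j u - w₁ i u) * logLame g i j u) +
        M u * (pd j (w₂ i) u - (w₂ j u - w₂ i u) * logLame g i j u) =
      ε j u * (N u * v i u - M u) := by
    intro u hu i j hij
    have h1 := (((hNp u hu j).mul (hw1p u hu i j)).add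
      ((hMp u hu j).mul (hw2p u hu i j))).eq_of_eqOn
        (((hrp u hu j).add ((hsp u hu j).mul (hasPd_of_contDiffOn hU (hv.1 i) hu j))).sub
          (hg.hasPd_hess hU hsemi hN hdN hu hij)) hU hu (fun u hu => hw.flow_N u hu i)
    rw [hva u hu i j hij, hr u hu, hs u hu, hw.curvature u hu i j hij] at h1
    linear_combination h1 - logLame g i j u * (hw.flow_N u hu j - hw.flow_N u hu i)
  refine ⟨ε, hεc, hp, hq, hr, hs, fun u hu i j hij => ?_, fun u hu i j hij => ?_⟩
  · refine mul_left_cancel₀ (hD u hu) ?_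
    linear_combination M u * fB u hu i j hij - A u * fN u hu i j hij
  · refine mul_left_cancel₀ (hD u hu) ?_
    linear_combination B u * fN u hu i j hij - N u * fB u hu i j hij

/-- The one-form `∑ ε_j du^j` is closed: it drops out of the mixed derivatives of the `w₂^i`, which
otherwise agree since `g` is semi-Hamiltonian. A third index `i` is needed here. -/
theorem CurvatureData.Defect.closed (hn : 3 ≤ n) (hU : IsOpen U) (hg : IsDiagMetric U g)
    (hsemi : IsSemiHamiltonian U g) {w₁ w₂ : Fin n → Scal n} {p q r s : Scal n}
    (hw₂ : ∀ i, ContDiffOn ℝ ∞ (w₂ i) U) {ε : Fin n → Scal n}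
    (h : Defect U v g B A N M w₁ w₂ p q r s ε) :
    ∀ u ∈ U, ∀ j k, pd j (ε k) u = pd k (ε j) u := by
  intro u hu j k
  rcases eq_or_ne j k with rfl | hjk
  · rfl
  obtain ⟨i, hi⟩ := exists_notMem_of_card_lt (n := n) (s := {j, k})
    (Finset.card_le_two.trans_lt (by omega))
  have hij : i ≠ j := fun h => hi (by simp [h])
  have hik : i ≠ k := fun h => hi (by simp [h])
  have key : ∀ j k, i ≠ j → i ≠ k → pd k (ε j) u =
      (w₂ j u - w₂ i u) * pd k (logLame g i j) u +
        (pd k (w₂ j) u - pd k (w₂ i) u) * logLame g i j u - pd k (pd j (w₂ i)) u := by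
    intro j k hij hik
    refine (((((hasPd_of_contDiffOn hU (hw₂ j) hu k).sub
      (hasPd_of_contDiffOn hU (hw₂ i) hu k)).mul
      (hasPd_of_contDiffOn hU (hg.contDiffOn_logLame hU i j) hu k)).sub
      (hasPd_of_contDiffOn hU (contDiffOn_pd hU (hw₂ i) j) hu k)).congr_of_eqOn hU hu
      fun u hu => ?_).pd_eq
    rw [h.pd_w₂ u hu i j hij]
    ring
  rw [key j k hij hik, key k j hik hij, pd_comm hU (hw₂ i) hu k j,
    h.pd_w₂ u hu j k hjk, h.pd_w₂ u hu k j hjk.symm, h.pd_w₂ u hu i k hik, h.pd_w₂ u hu i j hij,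
    hsemi u hu i j k hij hik hjk, hsemi u hu i k j hik hij hjk.symm]
  ring

/-- Affinors for which the curvature condition holds and both generating densities, with suitable
fluxes, are Casimirs. -/
theorem IsReciprocal.exists_affinors (hn : 3 ≤ n) (hU : IsOpen U) (hUsc : IsSimplyConnected U)
    (hv : IsStrictlyHyperbolic U v) (hg : IsMetricOfDNSystem U v g)
    (hrec : IsReciprocal U v B A N M) (hflat : IsFlatMetric U (recMetric v g B A N M)) :
    ∃ (w₁ w₂ : Fin n → Scal n) (p q r s : Scal n), IsAffinor U g w₁ ∧ IsAffinor U g w₂ ∧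
      HasSpecialCurvature U v g w₁ w₂ ∧
      Integral.IsCasimir U v g w₁ w₂ ⟨B, A, p, q⟩ ∧ Integral.IsCasimir U v g w₁ w₂ ⟨N, M, r, s⟩ := by
  have hsemi := hg.isSemiHamiltonian hU
  have hva : ∀ u ∈ U, ∀ i j, i ≠ j → pd j (v i) u = (v j u - v i u) * logLame g i j u :=
    fun u hu i j hij => hg.pd_velocity hU hu hij
  obtain ⟨w₁, w₂, p, q, r, s, hw⟩ :=
    exists_curvatureData (by omega) hU hg.1 hv.1 hva hrec hflat
  obtain ⟨ε, hε⟩ := hw.exists_defect (by omega) hU hg.1 hsemi hv hva hrec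
  obtain ⟨c, hc, hcε⟩ := exists_pd_eq_of_closed hU hUsc hε.smooth
    (hε.closed hn hU hg.1 hsemi hw.smooth_w₂)
  have hcp : ∀ u ∈ U, ∀ j, HasPd j c (ε j u) u := fun u hu j =>
    (hasPd_of_contDiffOn hU hc hu j).congr_deriv (hcε u hu j)
  have hB := hrec.1.1
  have hA := hrec.1.2.1
  have hN := hrec.2.1.1
  have hM := hrec.2.1.2.1
  have hBp := fun (u : Fin n → ℝ) (hu : u ∈ U) i => hasPd_of_contDiffOn hU hB hu i
  have hNp := fun (u : Fin n → ℝ) (hu : u ∈ U) i => hasPd_of_contDiffOn hU hN hu i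
  have hAp := fun (u : Fin n → ℝ) (hu : u ∈ U) i => hrec.1.hasPd hU hu i
  have hMp := fun (u : Fin n → ℝ) (hu : u ∈ U) i => hrec.2.1.hasPd hU hu i
  have hw1 : ∀ i, ContDiffOn ℝ ∞ (fun u => w₁ i u - c u * v i u) U := fun i =>
    (hw.smooth_w₁ i).sub (hc.mul (hv.1 i))
  have hw2 : ∀ i, ContDiffOn ℝ ∞ (fun u => w₂ i u + c u) U := fun i => (hw.smooth_w₂ i).add hc
  refine ⟨fun i u => w₁ i u - c u * v i u, fun i u => w₂ i u + c u,
    fun u => -(p u + c u * A u), fun u => -(q u - c u * B u),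
    fun u => -(r u + c u * M u), fun u => -(s u - c u * N u), ⟨hw1, ?_⟩, ⟨hw2, ?_⟩, ?_,
    ⟨⟨hrec.1, ⟨hB, (hw.smooth_p.add (hc.mul hA)).neg, ?_⟩,
      hB, (hw.smooth_q.sub (hc.mul hB)).neg, ?_⟩, ?_⟩,
    ⟨⟨hrec.2.1, ⟨hN, (hw.smooth_r.add (hc.mul hM)).neg, ?_⟩,
      hN, (hw.smooth_s.sub (hc.mul hN)).neg, ?_⟩, ?_⟩⟩
  · intro u hu i j hij
    rw [((hasPd_of_contDiffOn hU (hw.smooth_w₁ i) hu j).sub ((hcp u hu j).mul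
      (hasPd_of_contDiffOn hU (hv.1 i) hu j))).pd_eq, hε.pd_w₁ u hu i j hij, hva u hu i j hij,
      christoffel_self_left]
    ring
  · intro u hu i j hij
    rw [((hasPd_of_contDiffOn hU (hw.smooth_w₂ i) hu j).add (hcp u hu j)).pd_eq,
      hε.pd_w₂ u hu i j hij, christoffel_self_left]
    ring
  · intro u hu i j hij
    rw [hw.curvature u hu i j hij]
    ring
  · intro u hu j
    rw [((hasPd_of_contDiffOn hU hw.smooth_p hu j).add ((hcp u hu j).mul (hAp u hu j))).neg.pd_eq,
      hε.pd_p u hu j]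
    ring
  · intro u hu j
    rw [((hasPd_of_contDiffOn hU hw.smooth_q hu j).sub ((hcp u hu j).mul (hBp u hu j))).neg.pd_eq,
      hε.pd_q u hu j]
    ring
  · intro u hu i
    simp only [Integral.flow]
    linear_combination hw.flow_B u hu i
  · intro u hu j
    rw [((hasPd_of_contDiffOn hU hw.smooth_r hu j).add ((hcp u hu j).mul (hMp u hu j))).neg.pd_eq,
      hε.pd_r u hu j]
    ring
  · intro u hu j
    rw [((hasPd_of_contDiffOn hU hw.smooth_s hu j).sub ((hcp u hu j).mul (hNp u hu j))).neg.pd_eq,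
      hε.pd_s u hu j]
    ring
  · intro u hu i
    simp only [Integral.flow]
    linear_combination hw.flow_N u hu i

end

/-! ### Uniqueness of the affinors -/

/-- The vectors `(1, v_i, a_i, b_i)` are pairwise orthogonal for a non-degenerate quadratic form of
signature `(2, 2)`. Being at least five they are linearly dependent, so one of them is isotropic,
and this determines all the others. -/
theorem exists_const_of_pairwise_orthogonal (hn : 5 ≤ n) {a b v : Fin n → ℝ}
    (hv : ∀ i j, i ≠ j → v i ≠ v j)
    (h : ∀ i j, i ≠ j → a i + a j + b i * v j + b j * v i = 0) :
    ∃ c, ∀ i, b i = c ∧ a i = -c * v i := by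
  have hdep : ¬ LinearIndependent ℝ (fun i : Fin n => (![1, v i, a i, b i] : Fin 4 → ℝ)) := by
    intro hli
    have := hli.fintype_card_le_finrank
    simp only [Fintype.card_fin, Module.finrank_fin_fun] at this
    omega
  obtain ⟨l, hl, k, hk⟩ := Fintype.not_linearIndependent_iff.1 hdep
  have h0 : ∑ i, l i = 0 := by simpa [Finset.sum_apply] using congrFun hl 0
  have h1 : ∑ i, l i * v i = 0 := by simpa [Finset.sum_apply] using congrFun hl 1
  have h2 : ∑ i, l i * a i = 0 := by simpa [Finset.sum_apply] using congrFun hl 2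
  have h3 : ∑ i, l i * b i = 0 := by simpa [Finset.sum_apply] using congrFun hl 3
  -- pair the linear relation with the `k`-th vector
  have hk0 : a k + b k * v k = 0 := by
    have e1 : ∑ i, l i * (a i + a k + b i * v k + b k * v i) = 0 := by
      have : ∀ i, l i * (a i + a k + b i * v k + b k * v i) =
          l i * a i + l i * a k + l i * b i * v k + l i * v i * b k := fun i => by ring
      simp only [this, Finset.sum_add_distrib, ← Finset.sum_mul, h0, h1, h2, h3]
      ring
    rw [Finset.sum_eq_single k (fun i _ hik => by rw [h i k hik, mul_zero]) (by simp)] at e1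
    have := (mul_eq_zero.1 e1).resolve_left hk
    linarith
  have ha : ∀ i, i ≠ k → a i = -b k * v i - (b i - b k) * v k := fun i hik => by
    linear_combination h i k hik - hk0
  have hb2 : ∀ i j, i ≠ k → j ≠ k → i ≠ j →
      (b i - b k) * (v j - v k) + (b j - b k) * (v i - v k) = 0 := fun i j hik hjk hij => by
    linear_combination h i j hij - ha i hik - ha j hjk
  have hb : ∀ i, b i = b k := by
    intro i
    rcases eq_or_ne i k with rfl | hik
    · rfl
    obtain ⟨j, hj⟩ := exists_notMem_of_card_lt (n := n) (s := {i, k})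
      (Finset.card_le_two.trans_lt (by omega))
    obtain ⟨m, hm⟩ := exists_notMem_of_card_lt (n := n) (s := {i, j, k})
      (Finset.card_le_three.trans_lt (by omega))
    simp only [Finset.mem_insert, Finset.mem_singleton, not_or] at hj hm
    have e : 2 * (b i - b k) * ((v j - v k) * (v m - v k)) = 0 := by
      linear_combination (v m - v k) * hb2 i j hik hj.2 (Ne.symm hj.1) +
        (v j - v k) * hb2 i m hik hm.2.2 (Ne.symm hm.1) -
        (v i - v k) * hb2 j m hj.2 hm.2.2 (Ne.symm hm.2.1)
    have hne : (v j - v k) * (v m - v k) ≠ 0 :=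
      mul_ne_zero (sub_ne_zero.2 (hv j k hj.2)) (sub_ne_zero.2 (hv m k hm.2.2))
    linarith [(mul_eq_zero.1 e).resolve_right hne]
  refine ⟨b k, fun i => ⟨hb i, ?_⟩⟩
  rcases eq_or_ne i k with rfl | hik
  · linarith
  · rw [ha i hik, hb i]
    ring

section
variable {U : Set (Fin n → ℝ)} {v g : Fin n → Scal n} {w₁ w₂ w₁' w₂' : Fin n → Scal n}

/-- The affinors in the curvature condition are unique up to `w₁ - c v`, `w₂ + c` with a
constant `c`. -/
theorem HasSpecialCurvature.exists_const (hn : 5 ≤ n) (hU : IsOpen U) (hUc : IsPreconnected U)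
    (hv : IsStrictlyHyperbolic U v) (hw₂ : IsAffinor U g w₂) (hw₂' : IsAffinor U g w₂')
    (hc : HasSpecialCurvature U v g w₁ w₂) (hc' : HasSpecialCurvature U v g w₁' w₂') :
    ∃ c : ℝ, ∀ u ∈ U, ∀ i, w₂' i u = w₂ i u + c ∧ w₁' i u = w₁ i u - c * v i u := by
  have hpt : ∀ u ∈ U, ∃ c : ℝ, ∀ i, w₂' i u - w₂ i u = c ∧ w₁' i u - w₁ i u = -c * v i u := by
    intro u hu
    refine exists_const_of_pairwise_orthogonal hn (hv.2 u hu) fun i j hij => ?_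
    linear_combination hc u hu i j hij - hc' u hu i j hij
  have : Nontrivial (Fin n) := Fin.nontrivial_iff_two_le.2 (by omega)
  let k : Fin n := ⟨0, by omega⟩
  have hk : ∀ u ∈ U, ∀ i, w₂' k u - w₂ k u = w₂' i u - w₂ i u := fun u hu i => by
    obtain ⟨c, h⟩ := hpt u hu
    rw [(h k).1, (h i).1]
  obtain ⟨c, hcst⟩ := eq_const_of_pd_eq_zero hU hUc ((hw₂'.1 k).sub (hw₂.1 k)) (by
    intro u hu j
    obtain ⟨i, hij⟩ := exists_ne j
    have h1 := ((hasPd_of_contDiffOn hU (hw₂'.1 i) hu j).sub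
      (hasPd_of_contDiffOn hU (hw₂.1 i) hu j)).congr_of_eqOn
      (f' := fun u => w₂' k u - w₂ k u) hU hu fun u hu => hk u hu i
    rw [h1.pd_eq, hw₂'.2 u hu i j hij, hw₂.2 u hu i j hij]
    linear_combination christoffel g i i j u * (hk u hu i - hk u hu j))
  refine ⟨c, fun u hu i => ?_⟩
  obtain ⟨d, h⟩ := hpt u hu
  have hd : d = c := (h k).1.symm.trans (hcst u hu)
  subst hd
  exact ⟨by linarith [(h i).1], by linarith [(h i).2]⟩

/-! ### Canonical integrals -/

theorem Integral.IsCasimir.of_shift {h a p q : Scal n} {c : ℝ}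
    (hw : ∀ u ∈ U, ∀ i, w₂' i u = w₂ i u + c ∧ w₁' i u = w₁ i u - c * v i u) (hU : IsOpen U)
    (hC : Integral.IsCasimir U v g w₁ w₂ ⟨h, a, p, q⟩) :
    Integral.IsCasimir U v g w₁' w₂'
      ⟨h, a, fun u => p u - c * a u, fun u => q u + c * h u⟩ := by
  obtain ⟨⟨hha, hhp, hhq⟩, hflow⟩ := hC
  refine ⟨⟨hha, ⟨hha.1, hhp.2.1.sub (contDiffOn_const.mul hha.2.1), fun u hu i => ?_⟩,
    hha.1, hhq.2.1.add (contDiffOn_const.mul hha.1), fun u hu i => ?_⟩, fun u hu i => ?_⟩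
  · rw [((hhp.hasPd hU hu i).sub ((HasPd.const c).mul (hha.hasPd hU hu i))).pd_eq, (hw u hu i).2]
    ring
  · rw [((hhq.hasPd hU hu i).add
      ((HasPd.const c).mul (hasPd_of_contDiffOn hU hha.1 hu i))).pd_eq, (hw u hu i).1]
    ring
  · have := hflow u hu i
    simp only [Integral.flow] at this ⊢
    rw [(hw u hu i).1, (hw u hu i).2]
    linear_combination this

/-- The flux of a density along a flow is unique up to a constant. -/
theorem IsConservationLaw.exists_flux_eq_add_const (hU : IsOpen U) (hUc : IsPreconnected U)
    {h a a' : Scal n} (ha : IsConservationLaw U v h a) (ha' : IsConservationLaw U v h a') :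
    ∃ c : ℝ, ∀ u ∈ U, a' u = a u + c := by
  obtain ⟨c, hc⟩ := eq_const_of_pd_eq_zero hU hUc (ha'.2.1.sub ha.2.1) (fun u hu i =>
    ((ha'.hasPd hU hu i).sub (ha.hasPd hU hu i)).pd_eq.trans (sub_self _))
  exact ⟨c, fun u hu => by have : a' u - a u = c := hc u hu; linarith⟩

/-- If `⟨h, a, p, q⟩` is a Casimir, then `h` generates a combination of the `x`- and `t`-flows for
every choice of the fluxes along `w₁` and `w₂`. -/
theorem Integral.IsCasimir.exists_flow_eq (hU : IsOpen U) (hUc : IsPreconnected U)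
    {h a p q T₁ T₂ : Scal n} (hC : Integral.IsCasimir U v g w₁ w₂ ⟨h, a, p, q⟩)
    (hT : Integral.IsConserved U v w₁ w₂ ⟨h, a, T₁, T₂⟩) :
    ∃ κ₁ κ₂ : ℝ, ∀ u ∈ U, ∀ i,
      Integral.flow v g w₁ w₂ ⟨h, a, T₁, T₂⟩ i u = κ₁ + κ₂ * v i u := by
  obtain ⟨κ₁, h₁⟩ := hC.1.2.1.exists_flux_eq_add_const hU hUc hT.2.1
  obtain ⟨κ₂, h₂⟩ := hC.1.2.2.exists_flux_eq_add_const hU hUc hT.2.2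
  refine ⟨κ₁, κ₂, fun u hu i => ?_⟩
  have h0 := hC.2 u hu i
  have e₁ : T₁ u = p u + κ₁ := h₁ u hu
  have e₂ : T₂ u = q u + κ₂ := h₂ u hu
  simp only [Integral.flow] at h0 ⊢
  rw [e₁, e₂]
  linear_combination h0

/-- With shifted fluxes a Casimir generates any prescribed combination of the `x`- and
`t`-flows. -/
theorem Integral.IsCasimir.generates_shift (hU : IsOpen U) {h a p q : Scal n} (κ₁ κ₂ : ℝ)
    (hC : Integral.IsCasimir U v g w₁ w₂ ⟨h, a, p, q⟩) :
    Integral.Generates U v g w₁ w₂ ⟨h, a, fun u => p u + κ₁, fun u => q u + κ₂⟩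
      (fun i u => κ₁ + κ₂ * v i u) := by
  obtain ⟨⟨hha, hhp, hhq⟩, hflow⟩ := hC
  refine ⟨⟨hha, ⟨hha.1, hhp.2.1.add contDiffOn_const, fun u hu i => ?_⟩,
    hha.1, hhq.2.1.add contDiffOn_const, fun u hu i => ?_⟩, fun u hu i => ?_⟩
  · rw [((hhp.hasPd hU hu i).add (HasPd.const κ₁)).pd_eq, add_zero]
  · rw [((hhq.hasPd hU hu i).add (HasPd.const κ₂)).pd_eq, add_zero]
  · have := hflow u hu i
    simp only [Integral.flow] at this ⊢
    linear_combination this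

theorem IsConservationLaw.sub_smul (hU : IsOpen U) {h a k b l c : Scal n} (α β : ℝ)
    (ha : IsConservationLaw U v h a) (hb : IsConservationLaw U v k b)
    (hc : IsConservationLaw U v l c) :
    IsConservationLaw U v (fun u => h u - α * k u - β * l u)
      (fun u => a u - α * b u - β * c u) := by
  refine ⟨(ha.1.sub (contDiffOn_const.mul hb.1)).sub (contDiffOn_const.mul hc.1),
    (ha.2.1.sub (contDiffOn_const.mul hb.2.1)).sub (contDiffOn_const.mul hc.2.1), ?_⟩
  intro u hu i
  rw [(((ha.hasPd hU hu i).sub ((HasPd.const α).mul (hb.hasPd hU hu i))).sub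
      ((HasPd.const β).mul (hc.hasPd hU hu i))).pd_eq,
    (((hasPd_of_contDiffOn hU ha.1 hu i).sub ((HasPd.const α).mul
      (hasPd_of_contDiffOn hU hb.1 hu i))).sub ((HasPd.const β).mul
      (hasPd_of_contDiffOn hU hc.1 hu i))).pd_eq]
  ring

theorem hess_sub_smul (hU : IsOpen U) {h k l : Scal n} (hh : ContDiffOn ℝ ∞ h U)
    (hk : ContDiffOn ℝ ∞ k U) (hl : ContDiffOn ℝ ∞ l U) (α β : ℝ) {u : Fin n → ℝ} (hu : u ∈ U)
    (i j : Fin n) :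
    hess g (fun u => h u - α * k u - β * l u) i j u =
      hess g h i j u - α * hess g k i j u - β * hess g l i j u := by
  have h1 : ∀ u ∈ U, ∀ m, pd m (fun u => h u - α * k u - β * l u) u =
      pd m h u - α * pd m k u - β * pd m l u := by
    intro u hu m
    rw [(((hasPd_of_contDiffOn hU hh hu m).sub ((HasPd.const α).mul
      (hasPd_of_contDiffOn hU hk hu m))).sub ((HasPd.const β).mul
      (hasPd_of_contDiffOn hU hl hu m))).pd_eq]
    ring
  have h2 := ((((hasPd_of_contDiffOn hU (contDiffOn_pd hU hh j) hu i).sub ((HasPd.const α).mul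
      (hasPd_of_contDiffOn hU (contDiffOn_pd hU hk j) hu i))).sub ((HasPd.const β).mul
      (hasPd_of_contDiffOn hU (contDiffOn_pd hU hl j) hu i))).congr_of_eqOn hU hu
      fun u hu => h1 u hu j).pd_eq
  have h3 : ∑ m, christoffel g m i j u * pd m (fun u => h u - α * k u - β * l u) u =
      ∑ m, christoffel g m i j u * pd m h u - α * ∑ m, christoffel g m i j u * pd m k u -
        β * ∑ m, christoffel g m i j u * pd m l u := by
    simp only [h1 u hu, Finset.mul_sum, ← Finset.sum_sub_distrib]
    exact Finset.sum_congr rfl fun m _ => by ring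
  rw [hess, h2, h3, hess, hess, hess]
  ring

/-- An integral that generates `α u_x + β u_t` is a Casimir up to multiples of any given momentum
and Hamiltonian. -/
theorem Integral.exists_isCombination (hU : IsOpen U) {D P H : Integral n} {α β : ℝ}
    (hD : D.Generates U v g w₁ w₂ (fun i u => α + β * v i u)) (hP : P.IsMomentum U v g w₁ w₂)
    (hH : H.IsHamiltonian U v g w₁ w₂) :
    ∃ (C : Integral n) (α β : ℝ), C.IsCasimir U v g w₁ w₂ ∧ D.IsCombination U C P H α β := by
  refine ⟨⟨fun u => D.h u - α * P.h u - β * H.h u, fun u => D.a u - α * P.a u - β * H.a u,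
    fun u => D.T₁ u - α * P.T₁ u - β * H.T₁ u, fun u => D.T₂ u - α * P.T₂ u - β * H.T₂ u⟩, α, β,
    ⟨⟨hD.1.1.sub_smul hU α β hP.1.1 hH.1.1, hD.1.2.1.sub_smul hU α β hP.1.2.1 hH.1.2.1,
      hD.1.2.2.sub_smul hU α β hP.1.2.2 hH.1.2.2⟩, fun u hu i => ?_⟩, fun u _ => ?_⟩
  · have h1 := hD.2 u hu i
    have h2 := hP.2 u hu i
    have h3 := hH.2 u hu i
    simp only [Integral.flow] at h1 h2 h3 ⊢
    rw [hess_sub_smul hU hD.1.1.1 hP.1.1.1 hH.1.1.1 α β hu]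
    linear_combination h1 - α * h2 - β * h3
  · refine ⟨?_, ?_, ?_, ?_⟩ <;> ring

end

end Hydro

end

theorem mainTheorem1 {n : ℕ} (hn : 5 ≤ n) (U : Set (Fin n → ℝ)) (hU : IsOpen U)
    (hUsc : IsSimplyConnected U) (v g : Fin n → Hydro.Scal n)
    (hv : Hydro.IsStrictlyHyperbolic U v) (hg : Hydro.IsMetricOfDNSystem U v g)
    (B A N M : Hydro.Scal n) (hrec : Hydro.IsReciprocal U v B A N M)
    (hflat : Hydro.IsFlatMetric U (Hydro.recMetric v g B A N M)) :
    (∃ w₁ w₂ : Fin n → Hydro.Scal n, Hydro.IsAffinor U g w₁ ∧ Hydro.IsAffinor U g w₂ ∧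
      Hydro.HasSpecialCurvature U v g w₁ w₂) ∧
    (∀ w₁ w₂ : Fin n → Hydro.Scal n, Hydro.IsAffinor U g w₁ → Hydro.IsAffinor U g w₂ →
      Hydro.HasSpecialCurvature U v g w₁ w₂ →
      (∃ T₁ T₂ Z₁ Z₂ : Hydro.Scal n,
        Hydro.Integral.IsConserved U v w₁ w₂ ⟨B, A, T₁, T₂⟩ ∧
        Hydro.Integral.IsConserved U v w₁ w₂ ⟨N, M, Z₁, Z₂⟩) ∧
      (∀ T₁ T₂ : Hydro.Scal n, Hydro.Integral.IsConserved U v w₁ w₂ ⟨B, A, T₁, T₂⟩ →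
        Hydro.Integral.IsCanonical U v g w₁ w₂ ⟨B, A, T₁, T₂⟩ ∧
        ∃ κ₁ κ₂ : ℝ, ∀ u ∈ U, ∀ i,
          Hydro.Integral.flow v g w₁ w₂ ⟨B, A, T₁, T₂⟩ i u = κ₁ + κ₂ * v i u) ∧
      (∀ Z₁ Z₂ : Hydro.Scal n, Hydro.Integral.IsConserved U v w₁ w₂ ⟨N, M, Z₁, Z₂⟩ →
        Hydro.Integral.IsCanonical U v g w₁ w₂ ⟨N, M, Z₁, Z₂⟩ ∧
        ∃ κ₃ κ₄ : ℝ, ∀ u ∈ U, ∀ i,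
          Hydro.Integral.flow v g w₁ w₂ ⟨N, M, Z₁, Z₂⟩ i u = κ₃ + κ₄ * v i u)) := by

  have hUc : IsPreconnected U := hUsc.isPathConnected.isConnected.isPreconnected
  obtain ⟨w₁, w₂, p, q, r, s, hw₁, hw₂, hcurv, hCB, hCN⟩ :=
    hrec.exists_affinors (by omega) hU hUsc hv hg hflat
  refine ⟨⟨w₁, w₂, hw₁, hw₂, hcurv⟩, fun w₁' w₂' _ hw₂' hcurv' => ?_⟩
  obtain ⟨c, hc⟩ := hcurv.exists_const hn hU hUc hv hw₂ hw₂' hcurv'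
  have hCB' := hCB.of_shift hc hU
  have hCN' := hCN.of_shift hc hU
  -- with suitable fluxes `B` is a momentum and `N` is a Hamiltonian
  have hex : ∃ P H : Hydro.Integral n, P.IsMomentum U v g w₁' w₂' ∧
      H.IsHamiltonian U v g w₁' w₂' := by
    refine ⟨_, _, ⟨(hCB'.generates_shift hU 1 0).1, fun u hu i => ?_⟩,
      ⟨(hCN'.generates_shift hU 0 1).1, fun u hu i => ?_⟩⟩
    · rw [(hCB'.generates_shift hU 1 0).2 u hu i]; ring
    · rw [(hCN'.generates_shift hU 0 1).2 u hu i]; ring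
  refine ⟨⟨_, _, _, _, hCB'.1, hCN'.1⟩, fun T₁ T₂ hT => ?_, fun Z₁ Z₂ hZ => ?_⟩
  · obtain ⟨κ₁, κ₂, hκ⟩ := hCB'.exists_flow_eq hU hUc hT
    exact ⟨⟨hex, fun P H hP hH => Hydro.Integral.exists_isCombination hU ⟨hT, hκ⟩ hP hH⟩,
      κ₁, κ₂, hκ⟩
  · obtain ⟨κ₃, κ₄, hκ⟩ := hCN'.exists_flow_eq hU hUc hZ
    exact ⟨⟨hex, fun P H hP hH => Hydro.Integral.exists_isCombination hU ⟨hZ, hκ⟩ hP hH⟩,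
      κ₃, κ₄, hκ⟩
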